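/- Let $k$ be an algebraically closed field of characteristic zero and let $S\subset k^3$ be a rational ruled surface, i.e. an irreducible algebraic surface such that there is a dominant rational map $k^2\dashrightarrow S$ (a rational parametrization of $S$) and such that through every point of $S$ there passes a line contained in $S$. A rational map $k^2\dashrightarrow k^3$ is in ruled form if it can be written as $\left(\frac{\alpha_i(s)+t\,\beta_i(s)}{\gamma(s)}\right)_{i=1,2,3}$ with polynomials $\alpha_i,\beta_i,\gamma\in k[s]$, $\gamma\neq 0$. The image of a rational map is the set of its values at the points where it is defined. A standardized ruled parametrization of $S$ is given by polynomials $r_i,p_i,q\in k[s]$, $q\ne 0$, such that $$\mathcal P(s,t)=\left(\frac{r_i(s)+t\,p_i(s)}{q(s)}\right)_{i=1,2,3}$$ is a dominant rational map $k^2\dashrightarrow S$, not all $p_i$ are zero, the nonzero $p_i$ have the same degree, and the nonzero $p_i$ have no common root. An affine base point of it is a point $(a,b)\in k^2$ with $q(a)=0$ and $r_i(a)+b\,p_i(a)=0$ for $i=1,2,3$. Then $S$ can be covered by at most two rational parametrizations in ruled form. More precisely: 1. $S$ has a standardized ruled parametrization without affine base points. 2. For every standardized ruled parametrization $\mathcal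 P$ of $S$ without affine base points, either $\operatorname{Image}(\mathcal P)=S$, or there is a line $L\subset S$ with $S\setminus\operatorname{Image}(\mathcal P)\subseteq L$ such that for every index $j$ with $p_j\neq0$, putting $$\mathcal Q(s,t)=\mathcal P\left(s,\frac{q(s)\,t-r_j(s)}{p_j(s)}\right),\qquad \mathcal H(s,t)=\mathcal Q\left(\frac1s,t\right),$$ the map $\mathcal H$ is a rational parametrization of $S$ in ruled form, $\mathcal H$ is defined at $(0,t)$ for all $t\in k$, $t\mapsto\mathcal H(0,t)$ is an affine parametrization $t\mapsto c+t\,v$ ($v\neq0$) of the line $L$, and $S=\operatorname{Image}(\mathcal P)\cup\operatorname{Image}(\mathcal H)$. -/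

import Mathlib

noncomputable section

namespace RuledSurface

/-- The field `k(s,t)` of rational functions in two variables. -/
abbrev FunctionField (k : Type*) [Field k] : Type _ :=
  FractionRing (MvPolynomial (Fin 2) k)

/-- The parameter `s`, as an element of `k(s,t)`. -/
def paramS (k : Type*) [Field k] : FunctionField k :=
  algebraMap (MvPolynomial (Fin 2) k) (FunctionField k) (MvPolynomial.X 0)

/-- The parameter `t`, as an element of `k(s,t)`. -/
def paramT (k : Type*) [Field k] : FunctionField k :=
  algebraMap (MvPolynomial (Fin 2) k) (FunctionField k) (MvPolynomial.X 1)

variable {k : Type*} [Field k]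

/-- The rational map `P : k² ⇢ k³` is defined at `x`, with value `y`: every component of `P` can
be written as a fraction `a / b` of polynomials with `b x ≠ 0`, and `y i = a x / b x`. -/
def HasValueAt (P : Fin 3 → FunctionField k) (x : Fin 2 → k) (y : Fin 3 → k) : Prop :=
  ∀ i, ∃ a b : MvPolynomial (Fin 2) k,
    MvPolynomial.eval x b ≠ 0 ∧
    P i = algebraMap (MvPolynomial (Fin 2) k) (FunctionField k) a /
      algebraMap (MvPolynomial (Fin 2) k) (FunctionField k) b ∧
    y i = MvPolynomial.eval x a / MvPolynomial.eval x b

/-- The set of values of a rational map at the points where it is defined. -/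
def image (P : Fin 3 → FunctionField k) : Set (Fin 3 → k) :=
  {y | ∃ x : Fin 2 → k, HasValueAt P x y}

/-- Zariski closure of a subset of affine 3-space. -/
def zariskiClosure (A : Set (Fin 3 → k)) : Set (Fin 3 → k) :=
  MvPolynomial.zeroLocus k (MvPolynomial.vanishingIdeal k A)

/-- `P` is a rational parametrization of `S`, i.e. a dominant rational map `k² ⇢ S`. -/
def Parametrizes (P : Fin 3 → FunctionField k) (S : Set (Fin 3 → k)) : Prop :=
  zariskiClosure (image P) = S

/-- Irreducible algebraic surface in affine 3-space. -/
def IsSurface (S : Set (Fin 3 → k)) : Prop :=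
  ∃ F : MvPolynomial (Fin 3) k, Irreducible F ∧ S = {x | MvPolynomial.eval x F = 0}

/-- Affine line in 3-space. -/
def IsLine (L : Set (Fin 3 → k)) : Prop :=
  ∃ c v : Fin 3 → k, v ≠ 0 ∧ L = Set.range (fun τ : k => c + τ • v)

/-- Rational ruled surface: an irreducible surface which admits a rational parametrization and
which contains, through each of its points, a line. -/
structure IsRationalRuledSurface (S : Set (Fin 3 → k)) : Prop where
  surface : IsSurface S
  rational : ∃ P : Fin 3 → FunctionField k, Parametrizes P S
  ruled : ∀ x ∈ S, ∃ L : Set (Fin 3 → k), IsLine L ∧ x ∈ L ∧ L ⊆ S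

variable (k) in
/-- Polynomials `rᵢ, pᵢ, q` in one variable, with `q ≠ 0`; they stand for the triple
`((rᵢ(s) + t pᵢ(s)) / q(s))`. -/
structure RuledForm where
  r : Fin 3 → Polynomial k
  p : Fin 3 → Polynomial k
  q : Polynomial k
  q_ne_zero : q ≠ 0

namespace RuledForm

/-- Substitution: the triple `((rᵢ(σ) + τ pᵢ(σ)) / q(σ))` for `σ, τ ∈ k(s,t)`. -/
def subst (D : RuledForm k) (σ τ : FunctionField k) : Fin 3 → FunctionField k :=
  fun i => (Polynomial.aeval σ (D.r i) + τ * Polynomial.aeval σ (D.p i)) / Polynomial.aeval σ D.q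

/-- The rational map `𝒫(s,t) = ((rᵢ(s) + t pᵢ(s)) / q(s))`. -/
def toMap (D : RuledForm k) : Fin 3 → FunctionField k :=
  D.subst (paramS k) (paramT k)

/-- `𝒬(σ,τ) = 𝒫(σ, (q(σ) τ - r_j(σ)) / p_j(σ))`, for an index `j` with `p_j ≠ 0`. -/
def substQ (D : RuledForm k) (j : Fin 3) (σ τ : FunctionField k) : Fin 3 → FunctionField k :=
  D.subst σ
    ((Polynomial.aeval σ D.q * τ - Polynomial.aeval σ (D.r j)) / Polynomial.aeval σ (D.p j))

/-- `ℋ(s,t) = 𝒬(1/s, t)`. -/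
def mapH (D : RuledForm k) (j : Fin 3) : Fin 3 → FunctionField k :=
  D.substQ j (1 / paramS k) (paramT k)

/-- Standardized ruled parametrization of `S`: it is dominant onto `S`, the nonzero `pᵢ` have the
same degree, and the `pᵢ` have no common root (in particular they are not all zero). -/
structure IsStandardized (D : RuledForm k) (S : Set (Fin 3 → k)) : Prop where
  parametrizes : Parametrizes D.toMap S
  degree_eq : ∀ i j, D.p i ≠ 0 → D.p j ≠ 0 → (D.p i).natDegree = (D.p j).natDegree
  exists_ne_zero : ∃ i, D.p i ≠ 0
  no_common_root : ¬ ∃ a : k, ∀ i, D.p i ≠ 0 → (D.p i).eval a = 0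

/-- Affine base point: a common zero of the three numerators and of the denominator. -/
def IsAffineBasePoint (D : RuledForm k) (a b : k) : Prop :=
  D.q.eval a = 0 ∧ ∀ i, (D.r i).eval a + b * (D.p i).eval a = 0

end RuledForm

/-- A rational map is in ruled form if it is `((αᵢ(s) + t βᵢ(s)) / γ(s))` for some polynomials. -/
def IsInRuledForm (P : Fin 3 → FunctionField k) : Prop :=
  ∃ D : RuledForm k, P = D.toMap

end RuledSurface

end

/-! Existence. Let `S = {F = 0}`. A line of `S` through a point has its direction in the tangent
plane, a pencil with one unknown coordinate `α`; the lines correspond to common roots `α` of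
polynomials over the coordinate ring of `S`. Over the fraction field these generate a principal
ideal, so generically (`generic_common_roots`, `generic_directions`) either some line direction
depends rationally on the point, or two distinct lines pass through it. In the first case
(`exists_ruledForm_of_direction`) the lines are attached along a rational curve of `S`, the image of
a line of the parameter plane. In the second (`exists_ruledForm_of_two_lines`) a line with direction
`w` is fixed, and the other lines through its points have directions `u + θ w`. As both `w` and `u +
θ w` are isotropic for the Hessian of `F`, the equation for `θ` is linear and `θ` is rational,
unless the equation degenerates; then the tangent plane is constant along the line and `S` is a
plane. A nonconstant family of lines fills `S`, since infinitely many lines of `S` lie in no proper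
closed subset (`dvd_of_infinite_lines`). Standardization divides the `pᵢ` by their gcd, moves `s =
∞` to a general position and cancels base points. Covering. A point `x` lies on the line with
parameter `s` iff the minors of `(q x - r | p)` vanish at `s`; without base points such an `x` is a
value of `𝒫`. Since the projective line of parameters is complete (`exists_common_root_of_closure`,
by resultants), a point of `S` that is not a value satisfies the equations at `s = ∞`. Either these
are inconsistent and the image is `S`, or they define the line `L = ℋ(0, ·)`. -/

noncomputable section
namespace RuledSurface
open MvPolynomial

/-! ### Values of rational maps and the ideal of their image. -/

section Basic

universe u
variable {k : Type u} [Field k]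

/-- Clearing denominators in a polynomial expression in fractions with a common denominator,
uniformly in all specializations of the coefficient ring. -/
theorem exists_clear_denominators {σ : Type*} {A : Type*} [CommRing A] [Algebra k A]
    (a : σ → A) (b : A) (G : MvPolynomial σ k) :
    ∃ N : ℕ, ∀ M, N ≤ M → ∃ W : A, ∀ (Ω : Type u) [Field Ω] [Algebra k Ω] (φ : A →ₐ[k] Ω),
      φ b ≠ 0 → φ W = φ b ^ M * aeval (fun i => φ (a i) / φ b) G := by
  induction G using MvPolynomial.induction_on with
  | C c =>
    refine ⟨0, fun M _ => ⟨b ^ M * algebraMap k A c, fun Ω _ _ φ _ => ?_⟩⟩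
    simp
  | add p q hp hq =>
    obtain ⟨N, hN⟩ := hp
    obtain ⟨N', hN'⟩ := hq
    refine ⟨max N N', fun M hM => ?_⟩
    obtain ⟨W, hW⟩ := hN M (le_trans (le_max_left _ _) hM)
    obtain ⟨W', hW'⟩ := hN' M (le_trans (le_max_right _ _) hM)
    refine ⟨W + W', fun Ω _ _ φ h => ?_⟩
    rw [map_add, map_add, hW Ω φ h, hW' Ω φ h, mul_add]
  | mul_X p i hp =>
    obtain ⟨N, hN⟩ := hp
    refine ⟨N + 1, fun M hM => ?_⟩
    obtain ⟨M, rfl⟩ : ∃ M', M = M' + 1 := ⟨M - 1, by omega⟩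
    obtain ⟨W, hW⟩ := hN M (by omega)
    refine ⟨W * a i, fun Ω _ _ φ h => ?_⟩
    rw [map_mul, map_mul, hW Ω φ h, aeval_X]
    field_simp
    ring

theorem hasValueAt_of_common_denominator {P : Fin 3 → FunctionField k}
    {a : Fin 3 → MvPolynomial (Fin 2) k} {b : MvPolynomial (Fin 2) k}
    (hP : ∀ i, P i = algebraMap _ (FunctionField k) (a i) / algebraMap _ (FunctionField k) b)
    {z : Fin 2 → k} (hz : eval z b ≠ 0) :
    HasValueAt P z (fun i => eval z (a i) / eval z b) :=
  fun i => ⟨a i, b, hz, hP i, rfl⟩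

/-- The three components may come with different fractions at `z`, so the product of the
denominators serves as a common one. The cleared numerator of `G(P)` is zero as a polynomial, hence
also after specialization at `z`. -/
theorem eval_eq_zero_of_hasValueAt {P : Fin 3 → FunctionField k} {G : MvPolynomial (Fin 3) k}
    (hG : aeval P G = 0) {z : Fin 2 → k} {y : Fin 3 → k} (h : HasValueAt P z y) :
    eval y G = 0 := by
  choose a b hb hP hy using h
  have hinj := IsFractionRing.injective (MvPolynomial (Fin 2) k) (FunctionField k)
  have hb0 : ∀ i, b i ≠ 0 := fun i hi => hb i (by rw [hi, map_zero])
  set c : MvPolynomial (Fin 2) k := ∏ i, b i with hc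
  set a' : Fin 3 → MvPolynomial (Fin 2) k := fun i => a i * ∏ l ∈ Finset.univ.erase i, b l
    with ha'
  have hcprod : ∀ i, c = b i * ∏ l ∈ Finset.univ.erase i, b l := fun i =>
    (Finset.mul_prod_erase _ _ (Finset.mem_univ i)).symm
  have hc0 : c ≠ 0 := Finset.prod_ne_zero_iff.2 fun i _ => hb0 i
  have hcz : eval z c ≠ 0 := by
    rw [hc, map_prod]; exact Finset.prod_ne_zero_iff.2 fun i _ => hb i
  obtain ⟨N, hN⟩ := exists_clear_denominators a' c G
  obtain ⟨W, hW⟩ := hN N le_rfl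
  have hmap : ∀ (Ω : Type u) [Field Ω] [Algebra k Ω] (φ : MvPolynomial (Fin 2) k →ₐ[k] Ω),
      φ c ≠ 0 → ∀ i, φ (a' i) / φ c = φ (a i) / φ (b i) := by
    intro Ω _ _ φ hφ i
    have h1 : φ c = φ (b i) * φ (∏ l ∈ Finset.univ.erase i, b l) := by
      rw [← map_mul, ← hcprod i]
    rw [h1] at hφ
    rw [h1, ha']
    simp only [map_mul φ]
    exact mul_div_mul_right _ _ (right_ne_zero_of_mul hφ)
  have hcK : (Algebra.algHom k (MvPolynomial (Fin 2) k) (FunctionField k)) c ≠ 0 := fun h =>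
    hc0 (hinj (h.trans (map_zero _).symm))
  have hW0 : W = 0 := by
    have h1 := hW (FunctionField k) (Algebra.algHom k _ _) hcK
    apply hinj
    rw [map_zero]
    have h2 : (fun i => (Algebra.algHom k (MvPolynomial (Fin 2) k) (FunctionField k)) (a' i) /
        (Algebra.algHom k (MvPolynomial (Fin 2) k) (FunctionField k)) c) = P := by
      funext i
      rw [hmap _ _ hcK]
      exact (hP i).symm
    rw [h2, hG, mul_zero] at h1
    exact h1
  have h1 := hW k (aeval z) (by simpa [aeval_eq_eval] using hcz)
  have h2 : (fun i => (aeval z) (a' i) / (aeval z) c) = y := by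
    funext i
    rw [hmap _ _ (by simpa [aeval_eq_eval] using hcz), hy i]
    simp [aeval_eq_eval]
  rw [h2, hW0, map_zero, eq_comm, mul_eq_zero] at h1
  rcases h1 with h1 | h1
  · exact absurd (eq_zero_of_pow_eq_zero h1) (by simpa [aeval_eq_eval] using hcz)
  · simpa [aeval_eq_eval] using h1

/-- The cleared numerator of `G(P)`, multiplied by `h * b`, vanishes at every point, and over an
infinite field this makes it zero. -/
theorem aeval_eq_zero_of_forall_eval [Infinite k] {P : Fin 3 → FunctionField k}
    {a : Fin 3 → MvPolynomial (Fin 2) k} {b h : MvPolynomial (Fin 2) k} (hb : b ≠ 0) (hh : h ≠ 0)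
    (hP : ∀ i, P i = algebraMap _ (FunctionField k) (a i) / algebraMap _ (FunctionField k) b)
    {G : MvPolynomial (Fin 3) k}
    (hG : ∀ z, eval z h ≠ 0 → eval z b ≠ 0 →
      eval (fun i => eval z (a i) / eval z b) G = 0) : aeval P G = 0 := by
  obtain ⟨N, hN⟩ := exists_clear_denominators a b G
  obtain ⟨W, hW⟩ := hN N le_rfl
  have hW0 : W * h * b = 0 := by
    apply MvPolynomial.funext
    intro z
    rw [map_mul, map_mul, map_zero]
    by_cases h1 : eval z h = 0
    · rw [h1]; ring
    by_cases h2 : eval z b = 0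
    · rw [h2]; ring
    have h3 := hW k (aeval z) (by simpa [aeval_eq_eval] using h2)
    simp only [aeval_eq_eval] at h3
    rw [h3, hG z h1 h2]; ring
  have hW1 : W = 0 := by
    simpa [hb, hh] using hW0
  have hb' : algebraMap _ (FunctionField k) b ≠ 0 := by simpa using hb
  have h1 := hW (FunctionField k) (Algebra.algHom k _ _) hb'
  have h2 : (fun i => (Algebra.algHom k (MvPolynomial (Fin 2) k) (FunctionField k)) (a i) /
      (Algebra.algHom k (MvPolynomial (Fin 2) k) (FunctionField k)) b) = P := by
    funext i
    exact (hP i).symm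
  rw [h2, hW1, map_zero, eq_comm, mul_eq_zero] at h1
  exact h1.resolve_left (pow_ne_zero _ hb')

/-- The ideal of the image can be tested with one fixed representation by fractions and on any
nonempty principal open set `h ≠ 0`; all later density arguments use this. -/
theorem mem_vanishingIdeal_image_iff [Infinite k] {P : Fin 3 → FunctionField k}
    {a : Fin 3 → MvPolynomial (Fin 2) k} {b h : MvPolynomial (Fin 2) k} (hb : b ≠ 0) (hh : h ≠ 0)
    (hP : ∀ i, P i = algebraMap _ (FunctionField k) (a i) / algebraMap _ (FunctionField k) b)
    {G : MvPolynomial (Fin 3) k} :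
    G ∈ vanishingIdeal k (image P) ↔ ∀ z, eval z h ≠ 0 → eval z b ≠ 0 →
      eval (fun i => eval z (a i) / eval z b) G = 0 := by
  rw [mem_vanishingIdeal_iff]
  constructor
  · intro H z _ hz
    have := H _ ⟨z, hasValueAt_of_common_denominator hP hz⟩
    simpa [aeval_eq_eval] using this
  · rintro H y ⟨z, hz⟩
    have := eval_eq_zero_of_hasValueAt (aeval_eq_zero_of_forall_eval hb hh hP H) hz
    simpa [aeval_eq_eval] using this

theorem exists_common_denominator (P : Fin 3 → FunctionField k) :
    ∃ (a : Fin 3 → MvPolynomial (Fin 2) k) (b : MvPolynomial (Fin 2) k), b ≠ 0 ∧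
      ∀ i, P i = algebraMap _ (FunctionField k) (a i) / algebraMap _ (FunctionField k) b := by
  obtain ⟨b, hb⟩ := IsLocalization.exist_integer_multiples_of_finite
    (nonZeroDivisors (MvPolynomial (Fin 2) k)) P
  choose a ha using hb
  have hb0 : (b : MvPolynomial (Fin 2) k) ≠ 0 := nonZeroDivisors.coe_ne_zero b
  refine ⟨a, b, hb0, fun i => ?_⟩
  have hb' : algebraMap _ (FunctionField k) (b : MvPolynomial (Fin 2) k) ≠ 0 := by simp
  rw [eq_div_iff hb', ha i, Algebra.smul_def, mul_comm]

theorem image_subset_zariskiClosure (P : Fin 3 → FunctionField k) :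
    image P ⊆ zariskiClosure (image P) :=
  zeroLocus_vanishingIdeal_le _

theorem Parametrizes.image_subset {P : Fin 3 → FunctionField k} {S : Set (Fin 3 → k)}
    (h : Parametrizes P S) : image P ⊆ S :=
  h ▸ image_subset_zariskiClosure P

/-- The vanishing ideal of an irreducible hypersurface is generated by its equation. -/
theorem dvd_iff_forall_eval_eq_zero [IsAlgClosed k] {F G : MvPolynomial (Fin 3) k}
    (hF : Irreducible F) : F ∣ G ↔ ∀ x, eval x F = 0 → eval x G = 0 := by
  constructor
  · rintro ⟨H, rfl⟩ x hx
    rw [map_mul, hx, zero_mul]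
  · intro h
    have hprime : (Ideal.span {F}).IsPrime :=
      (Ideal.span_singleton_prime hF.ne_zero).2 hF.prime
    have h1 := IsPrime.vanishingIdeal_zeroLocus (K := k) (Ideal.span {F})
    rw [← Ideal.mem_span_singleton, ← h1, mem_vanishingIdeal_iff]
    intro x hx
    rw [zeroLocus_span] at hx
    have := hx F rfl
    simp only [aeval_eq_eval] at this ⊢
    exact h x this

theorem parametrizes_iff [IsAlgClosed k] {F : MvPolynomial (Fin 3) k} (hF : Irreducible F)
    {P : Fin 3 → FunctionField k} :
    Parametrizes P {x | eval x F = 0} ↔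
      ∀ G, G ∈ vanishingIdeal k (image P) ↔ F ∣ G := by
  have hprime : (Ideal.span {F}).IsPrime :=
    (Ideal.span_singleton_prime hF.ne_zero).2 hF.prime
  constructor
  · intro h G
    rw [dvd_iff_forall_eval_eq_zero hF]
    constructor
    · intro hG x hx
      have h1 : x ∈ zariskiClosure (image P) := by rw [h]; exact hx
      simpa [aeval_eq_eval] using h1 G hG
    · intro hG
      rw [mem_vanishingIdeal_iff]
      intro x hx
      simpa [aeval_eq_eval] using hG x (h.image_subset hx)
  · intro h
    have h1 : vanishingIdeal k (image P) = Ideal.span {F} := by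
      ext G; rw [h, Ideal.mem_span_singleton]
    unfold Parametrizes zariskiClosure
    rw [h1, zeroLocus_span]
    ext x
    simp [aeval_eq_eval]

end Basic

end RuledSurface
end

/-! ### Infinitely many lines on an irreducible surface are dense. -/

noncomputable section
namespace RuledSurface
open MvPolynomial

section Lines

variable {k : Type*} [Field k]

/-- A plane polynomial vanishing on infinitely many lines `x = a + b y` is zero. -/
theorem eq_zero_of_infinite_lines_plane [Infinite k] (c : MvPolynomial (Fin 2) k)
    (T : Set (k × k)) (hT : T.Infinite)
    (h : ∀ ab ∈ T, ∀ τ : k, eval ![ab.1 + ab.2 * τ, τ] c = 0) : c = 0 := by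
  rw [← map_eq_zero_iff (finSuccEquiv k 1) (finSuccEquiv k 1).injective]
  -- With `c` viewed as a polynomial in `x` over `k[y]`, the line `x = a + b y` is the root `a + b
  -- y`; distinct lines give distinct roots.
  let ρ : k × k → MvPolynomial (Fin 1) k := fun ab => C ab.1 + C ab.2 * X 0
  have hρ : Function.Injective ρ := by
    intro x y hxy
    have h0 := congrArg (eval (fun _ => 0)) hxy
    have h1 := congrArg (eval (fun _ => 1)) hxy
    simp only [ρ, map_add, eval_C, map_mul, eval_X, mul_zero, add_zero, mul_one] at h0 h1
    ext
    · exact h0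
    · rw [h0] at h1; exact add_left_cancel h1
  refine Polynomial.eq_zero_of_infinite_isRoot _ ((hT.image hρ.injOn).mono ?_)
  rintro _ ⟨ab, hab, rfl⟩
  rw [Set.mem_ofPred_eq, Polynomial.IsRoot]
  apply MvPolynomial.funext
  intro z
  rw [map_zero, eval_polynomial_eval_finSuccEquiv, ← h ab hab (z 0)]
  congr 2
  funext i
  refine Fin.cases ?_ (fun i => ?_) i
  · simp [ρ]
  · fin_cases i; rfl

/-- Elimination of the first variable from two coprime polynomials, in the situation where the
common zero set projects onto infinitely many lines. -/
theorem dvd_of_infinite_lines_chart [Infinite k] {F G : MvPolynomial (Fin 3) k}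
    (hF : Irreducible F) (T : Set (k × k)) (hT : T.Infinite)
    (h : ∀ ab ∈ T, ∃ a b : k, ∀ τ : k, eval ![a + b * τ, ab.1 + ab.2 * τ, τ] F = 0 ∧
      eval ![a + b * τ, ab.1 + ab.2 * τ, τ] G = 0) : F ∣ G := by
  classical
  set f := finSuccEquiv k 2 F with hf
  set g := finSuccEquiv k 2 G with hg
  have hev : ∀ (H : MvPolynomial (Fin 3) k) (x y z : k),
      eval ![x, y, z] H = eval ![y, z] ((finSuccEquiv k 2 H).eval (C x)) := by
    intro H x y z
    rw [eval_polynomial_eval_finSuccEquiv, eval_C]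
    rfl
  have hfirr : Irreducible f := (MulEquiv.irreducible_iff (finSuccEquiv k 2)).2 hF
  -- An element of the ideal `(f, g)` free of the first variable vanishes on the projections of all
  -- the lines, so it is zero. If `F ∤ G`, Gauss's lemma and a Bézout identity over the fraction
  -- field, cleared of denominators, would produce a nonzero such element.
  have key : ∀ c : MvPolynomial (Fin 2) k, (∃ A B, A * f + B * g = Polynomial.C c) → c = 0 := by
    rintro c ⟨A, B, hAB⟩
    refine eq_zero_of_infinite_lines_plane c T hT fun ab hab τ => ?_
    obtain ⟨a, b, hab'⟩ := h ab hab
    have h1 := congrArg (fun q => eval ![ab.1 + ab.2 * τ, τ] (Polynomial.eval (C (a + b * τ)) q))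
      hAB
    simp only [Polynomial.eval_add, Polynomial.eval_mul, map_add, map_mul, Polynomial.eval_C]
      at h1
    rw [← h1]
    have h2 := hab' τ
    rw [hev, hev] at h2
    simp only [map_add, map_mul] at h2
    rw [h2.1, h2.2]; ring
  by_cases hdeg : f.natDegree = 0
  · obtain ⟨c, hc⟩ := Polynomial.natDegree_eq_zero.1 hdeg
    have := key c ⟨1, 0, by rw [hc]; ring⟩
    rw [this, Polynomial.C_0] at hc
    exact absurd hc.symm hfirr.ne_zero
  · have hprim := hfirr.isPrimitive hdeg
    rw [← map_dvd_iff (finSuccEquiv k 2)]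
    let K := FractionRing (MvPolynomial (Fin 2) k)
    apply hprim.dvd_of_fraction_map_dvd_fraction_map (K := K)
    by_contra hnd
    have hK := (hprim.irreducible_iff_irreducible_map_fraction_map (K := K)).1 hfirr
    obtain ⟨A, B, hAB⟩ := (hK.coprime_iff_not_dvd).2 hnd
    obtain ⟨a, ha⟩ := IsLocalization.exist_integer_multiples_of_finset
      (nonZeroDivisors (MvPolynomial (Fin 2) k)) (A.coeffs ∪ B.coeffs)
    have hlift : ∀ q : Polynomial K, (∀ x ∈ q.coeffs, x ∈ A.coeffs ∪ B.coeffs) →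
        ∃ q' : Polynomial (MvPolynomial (Fin 2) k), q'.map (algebraMap _ K) =
          Polynomial.C (algebraMap _ K (a : MvPolynomial (Fin 2) k)) * q := by
      intro q hq
      rw [← Polynomial.mem_lifts, Polynomial.lifts_iff_coeff_lifts]
      intro n
      rw [Polynomial.coeff_C_mul]
      by_cases hn : q.coeff n = 0
      · exact ⟨0, by rw [hn]; simp⟩
      · obtain ⟨y, hy⟩ := ha _ (hq _ (Polynomial.coeff_mem_coeffs hn))
        exact ⟨y, by rw [hy, Algebra.smul_def]⟩
    obtain ⟨A', hA'⟩ := hlift A (fun x hx => Finset.mem_union_left _ hx)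
    obtain ⟨B', hB'⟩ := hlift B (fun x hx => Finset.mem_union_right _ hx)
    have := key a ⟨A', B', by
      apply Polynomial.map_injective _ (IsFractionRing.injective (MvPolynomial (Fin 2) k) K)
      rw [Polynomial.map_add, Polynomial.map_mul, Polynomial.map_mul, hA', hB', Polynomial.map_C,
        mul_assoc, mul_assoc, ← mul_add]
      rw [hAB, mul_one]⟩
    exact nonZeroDivisors.coe_ne_zero a this

theorem rename_perm_dvd {F G : MvPolynomial (Fin 3) k} (e : Equiv.Perm (Fin 3))
    (h : rename e F ∣ rename e G) : F ∣ G := by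
  have := (map_dvd_iff (renameEquiv k e) (a := F) (b := G))
  exact this.1 h

/-- Every line can be parametrized by one of the coordinates. -/
theorem exists_chart {L : Set (Fin 3 → k)} (hL : IsLine L) :
    ∃ (j : Fin 3) (a b : Fin 3 → k), a j = 0 ∧ b j = 1 ∧
      L = Set.range (fun τ : k => a + τ • b) := by
  obtain ⟨c, v, hv, rfl⟩ := hL
  obtain ⟨j, hj⟩ := Function.ne_iff.1 hv
  have hj' : v j ≠ 0 := hj
  refine ⟨j, c - (c j / v j) • v, (v j)⁻¹ • v, ?_, ?_, ?_⟩
  · simp [hj']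
  · simp [hj']
  · ext x
    constructor
    · rintro ⟨τ, rfl⟩
      refine ⟨c j + τ * v j, ?_⟩
      funext i
      simp only [Pi.add_apply, Pi.sub_apply, Pi.smul_apply, smul_eq_mul]
      field_simp
      ring
    · rintro ⟨τ, rfl⟩
      refine ⟨(τ - c j) / v j, ?_⟩
      funext i
      simp only [Pi.add_apply, Pi.sub_apply, Pi.smul_apply, smul_eq_mul]
      field_simp
      ring

/-- A surface that contains infinitely many lines on which `G` vanishes is contained in the zero
set of `G`. -/
theorem dvd_of_infinite_lines [Infinite k] {F G : MvPolynomial (Fin 3) k} (hF : Irreducible F)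
    (h : {L : Set (Fin 3 → k) | IsLine L ∧ ∀ x ∈ L, eval x F = 0 ∧ eval x G = 0}.Infinite) :
    F ∣ G := by
  classical
  set 𝓛 := {L : Set (Fin 3 → k) | IsLine L ∧ ∀ x ∈ L, eval x F = 0 ∧ eval x G = 0} with h𝓛
  let Γ : Fin 3 → Set ((Fin 3 → k) × (Fin 3 → k)) := fun j =>
    {ab | ab.1 j = 0 ∧ ab.2 j = 1 ∧ ∀ τ : k, eval (ab.1 + τ • ab.2) F = 0 ∧
      eval (ab.1 + τ • ab.2) G = 0}
  have hcover : 𝓛 ⊆ ⋃ j, (fun ab : (Fin 3 → k) × (Fin 3 → k) =>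
      Set.range (fun τ : k => ab.1 + τ • ab.2)) '' Γ j := by
    rintro L ⟨hL, hLz⟩
    obtain ⟨j, a, b, ha, hb, rfl⟩ := exists_chart hL
    exact Set.mem_iUnion.2 ⟨j, (a, b), ⟨ha, hb, fun τ => hLz _ ⟨τ, rfl⟩⟩, rfl⟩
  obtain ⟨j, hj⟩ : ∃ j, (Γ j).Infinite := by
    by_contra! hcon
    exact h ((Set.finite_iUnion fun j => (hcon j).image _).subset hcover)
  -- A line in chart `j` is determined by its three pairs `(aᵢ, bᵢ)`, the `j`-th being `(0, 1)`. If
  -- both other pairs took finitely many values, the chart would contain finitely many lines.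
  have hproj : ∃ i, i ≠ j ∧ ((fun ab : (Fin 3 → k) × (Fin 3 → k) => (ab.1 i, ab.2 i)) ''
      Γ j).Infinite := by
    by_contra! hcon
    apply hj
    have hfin : (Set.pi Set.univ (fun i => (fun ab : (Fin 3 → k) × (Fin 3 → k) =>
        (ab.1 i, ab.2 i)) '' Γ j)).Finite := by
      refine Set.Finite.pi fun i => ?_
      by_cases hi : i = j
      · subst hi
        refine (Set.finite_singleton ((0 : k), (1 : k))).subset ?_
        rintro _ ⟨ab, ⟨h0, h1, _⟩, rfl⟩
        simp [h0, h1]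
      · exact hcon i hi
    refine (hfin.preimage (f := fun (ab : (Fin 3 → k) × (Fin 3 → k)) i => (ab.1 i, ab.2 i))
      ?_).subset ?_
    · intro x _ y _ hxy
      ext i
      · exact congrArg Prod.fst (congrFun hxy i)
      · exact congrArg Prod.snd (congrFun hxy i)
    · intro ab hab i _
      exact ⟨ab, hab, rfl⟩
  obtain ⟨i, hij, hinf⟩ := hproj
  -- Coordinates are permuted so that the parameter `j` comes last, `i` comes second and the
  -- remaining coordinate is the one eliminated.
  obtain ⟨e, he1, he2⟩ : ∃ e : Equiv.Perm (Fin 3), e i = 1 ∧ e j = 2 := by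
    have : ∀ i j : Fin 3, i ≠ j → ∃ e : Equiv.Perm (Fin 3), e i = 1 ∧ e j = 2 := by decide
    exact this i j hij
  obtain ⟨l, hl⟩ : ∃ l, e l = 0 := e.surjective 0
  apply rename_perm_dvd e
  refine dvd_of_infinite_lines_chart
    ((MulEquiv.irreducible_iff (renameEquiv k e)).2 hF) _ hinf ?_
  rintro _ ⟨ab, ⟨h0, h1, h2⟩, rfl⟩
  refine ⟨ab.1 l, ab.2 l, fun τ => ?_⟩
  have hpt : (![ab.1 l + ab.2 l * τ, ab.1 i + ab.2 i * τ, τ] : Fin 3 → k) ∘ e =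
      ab.1 + τ • ab.2 := by
    have hs : ∀ m, m = l ∨ m = i ∨ m = j := by
      intro m
      have : e m = 0 ∨ e m = 1 ∨ e m = 2 := by
        generalize e m = y; fin_cases y <;> simp
      rwa [← hl, ← he1, ← he2, e.injective.eq_iff, e.injective.eq_iff, e.injective.eq_iff] at this
    funext m
    rcases hs m with rfl | rfl | rfl
    · simp [hl, mul_comm]
    · simp [he1, mul_comm]
    · simp [he2, h0, h1]
  rw [eval_rename, eval_rename, hpt]
  exact h2 τ

end Lines

end RuledSurface
end

/-! ### Ruled forms, their values, and dominance criteria. -/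

noncomputable section
namespace RuledSurface
open MvPolynomial

section Parallel

variable {k : Type*} [Field k]

theorem exists_smul_of_parallel {v w : Fin 3 → k} (hw : w ≠ 0)
    (h : ∀ i j, v i * w j = v j * w i) : ∃ c : k, v = c • w := by
  obtain ⟨j, hj⟩ := Function.ne_iff.1 hw
  have hj' : w j ≠ 0 := hj
  refine ⟨v j / w j, ?_⟩
  funext i
  rw [Pi.smul_apply, smul_eq_mul, div_mul_eq_mul_div, eq_div_iff hj', h i j]

/-- A polynomial vanishing at infinitely many points vanishes everywhere. -/
theorem eval_eq_zero_of_infinite {f : Polynomial k} {B : Set k} (hB : B.Infinite)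
    (h : ∀ u ∈ B, f.eval u = 0) (u : k) : f.eval u = 0 := by
  rw [Polynomial.eq_zero_of_infinite_isRoot f (hB.mono h), Polynomial.eval_zero]

theorem infinite_setOf_eval_ne_zero [Infinite k] {h : Polynomial k} (hh : h ≠ 0) :
    {u | h.eval u ≠ 0}.Infinite := by
  have : {u | h.eval u ≠ 0} = {u | h.IsRoot u}ᶜ := rfl
  rw [this]
  exact (Polynomial.finite_setOfPred_isRoot hh).infinite_compl

end Parallel

namespace RuledForm

universe u
variable {k : Type u} [Field k] (D : RuledForm k)

/-- The value `((rᵢ(u) + t pᵢ(u)) / q(u))` of a ruled form; meaningful if `q(u) ≠ 0`. -/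
def pt (u t : k) : Fin 3 → k :=
  fun i => ((D.r i).eval u + t * (D.p i).eval u) / D.q.eval u

/-- Numerators of a ruled form, as polynomials in two variables. -/
def num (i : Fin 3) : MvPolynomial (Fin 2) k :=
  Polynomial.aeval (X 0) (D.r i) + X 1 * Polynomial.aeval (X 0) (D.p i)

/-- Denominator of a ruled form, as a polynomial in two variables. -/
def den : MvPolynomial (Fin 2) k :=
  Polynomial.aeval (X 0) D.q

theorem eval_aeval_X_zero (z : Fin 2 → k) (f : Polynomial k) :
    eval z (Polynomial.aeval (X 0 : MvPolynomial (Fin 2) k) f) = f.eval (z 0) := by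
  have := Polynomial.aeval_algHom_apply (aeval z : MvPolynomial (Fin 2) k →ₐ[k] k) (X 0) f
  simp only [aeval_X, Polynomial.coe_aeval_eq_eval] at this
  rw [this]
  simp [aeval_eq_eval]

theorem aeval_X_zero_ne_zero {f : Polynomial k} (hf : f ≠ 0) :
    Polynomial.aeval (X 0 : MvPolynomial (Fin 2) k) f ≠ 0 := by
  have h : Transcendental k (X 0 : MvPolynomial (Fin 2) k) := transcendental_X k 0
  rw [transcendental_iff] at h
  exact fun h0 => hf (h f h0)

theorem eval_num (z : Fin 2 → k) (i : Fin 3) :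
    eval z (D.num i) = (D.r i).eval (z 0) + z 1 * (D.p i).eval (z 0) := by
  simp only [num, map_add, map_mul, eval_X, eval_aeval_X_zero]

theorem eval_den (z : Fin 2 → k) : eval z D.den = D.q.eval (z 0) :=
  eval_aeval_X_zero z _

theorem den_ne_zero : D.den ≠ 0 := aeval_X_zero_ne_zero D.q_ne_zero

theorem aeval_paramS (f : Polynomial k) :
    Polynomial.aeval (paramS k) f =
      algebraMap _ (FunctionField k) (Polynomial.aeval (X 0 : MvPolynomial (Fin 2) k) f) :=
  Polynomial.aeval_algebraMap_apply _ _ _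

theorem toMap_eq (i : Fin 3) :
    D.toMap i = algebraMap _ (FunctionField k) (D.num i) / algebraMap _ (FunctionField k) D.den := by
  simp only [toMap, subst, num, den, aeval_paramS, map_add, map_mul]
  rfl

theorem hasValueAt_pt {u : k} (hu : D.q.eval u ≠ 0) (t : k) :
    HasValueAt D.toMap ![u, t] (D.pt u t) := by
  have h := hasValueAt_of_common_denominator D.toMap_eq (z := ![u, t])
    (by simpa [eval_den] using hu)
  simp only [eval_num, eval_den] at h
  exact h

theorem pt_mem_image {u : k} (hu : D.q.eval u ≠ 0) (t : k) : D.pt u t ∈ image D.toMap :=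
  ⟨_, D.hasValueAt_pt hu t⟩

theorem mem_vanishingIdeal_iff [Infinite k] {h : Polynomial k} (hh : h ≠ 0)
    {G : MvPolynomial (Fin 3) k} :
    G ∈ vanishingIdeal k (image D.toMap) ↔
      ∀ u t, h.eval u ≠ 0 → D.q.eval u ≠ 0 → eval (D.pt u t) G = 0 := by
  rw [mem_vanishingIdeal_image_iff D.den_ne_zero (aeval_X_zero_ne_zero hh) D.toMap_eq]
  simp only [eval_num, eval_den, eval_aeval_X_zero]
  constructor
  · intro H u t h1 h2
    exact H ![u, t] h1 h2
  · intro H z h1 h2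
    exact H (z 0) (z 1) h1 h2

/-- Comparison of ruled forms whose general points are values of each other. -/
theorem vanishingIdeal_le [Infinite k] {D D' : RuledForm k} {h : Polynomial k} (hh : h ≠ 0)
    (H : ∀ u t, h.eval u ≠ 0 → D.q.eval u ≠ 0 →
      ∃ u' t', D'.q.eval u' ≠ 0 ∧ D.pt u t = D'.pt u' t') :
    vanishingIdeal k (image D'.toMap) ≤ vanishingIdeal k (image D.toMap) := by
  intro G hG
  rw [D.mem_vanishingIdeal_iff hh]
  rw [D'.mem_vanishingIdeal_iff one_ne_zero] at hG
  intro u t h1 h2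
  obtain ⟨u', t', h3, h4⟩ := H u t h1 h2
  rw [h4]
  exact hG u' t' (by simp) h3

/-- Changes of parameters below are justified by this criterion: only general values are compared,
so substitutions may be undefined for finitely many `u`. -/
theorem parametrizes_of_pt_eq [Infinite k] {D D' : RuledForm k} {S : Set (Fin 3 → k)}
    (hS : Parametrizes D.toMap S) {h h' : Polynomial k} (hh : h ≠ 0) (hh' : h' ≠ 0)
    (H : ∀ u t, h.eval u ≠ 0 → D.q.eval u ≠ 0 →
      ∃ u' t', D'.q.eval u' ≠ 0 ∧ D.pt u t = D'.pt u' t')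
    (H' : ∀ u t, h'.eval u ≠ 0 → D'.q.eval u ≠ 0 →
      ∃ u' t', D.q.eval u' ≠ 0 ∧ D'.pt u t = D.pt u' t') :
    Parametrizes D'.toMap S := by
  rw [← hS]
  unfold Parametrizes zariskiClosure
  rw [le_antisymm (vanishingIdeal_le hh H) (vanishingIdeal_le hh' H')]

theorem pt_eq_add_smul (u t : k) :
    D.pt u t = D.pt u 0 + t • fun i => (D.p i).eval u / D.q.eval u := by
  funext i
  simp only [pt, Pi.add_apply, Pi.smul_apply, smul_eq_mul]
  ring

theorem isLine_range_pt {u : k} (hq : D.q.eval u ≠ 0) (hp : ∃ i, (D.p i).eval u ≠ 0) :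
    IsLine (Set.range (D.pt u)) := by
  obtain ⟨i, hi⟩ := hp
  refine ⟨D.pt u 0, fun i => (D.p i).eval u / D.q.eval u, ?_, ?_⟩
  · exact fun h => div_ne_zero hi hq (congrFun h i)
  · congr 1
    funext t
    exact D.pt_eq_add_smul u t

/-- A nonconstant family of lines on an irreducible surface fills the surface. -/
theorem parametrizes_of_lines [IsAlgClosed k] {F : MvPolynomial (Fin 3) k} (hF : Irreducible F)
    (h : Polynomial k)
    (hD : ∀ u, h.eval u ≠ 0 → D.q.eval u ≠ 0 ∧ (∃ i, (D.p i).eval u ≠ 0) ∧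
      ∀ t, eval (D.pt u t) F = 0)
    {u₀ u₁ : k} (hu₀ : h.eval u₀ ≠ 0) (hu₁ : D.q.eval u₁ ≠ 0)
    (hne : ∀ t, D.pt u₁ 0 ≠ D.pt u₀ t) :
    Parametrizes D.toMap {x | eval x F = 0} := by
  have hh : h ≠ 0 := fun h0 => hu₀ (by rw [h0, Polynomial.eval_zero])
  -- With finitely many lines, infinitely many `u` give the line of one `u'`. The conditions for
  -- lying on that line are polynomial in `u`, so they hold identically; applied to `u₀` and `u₁`
  -- they contradict `hne`.
  have hinf : ((fun u => Set.range (D.pt u)) '' {u | h.eval u ≠ 0}).Infinite := by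
    intro hfin
    refine infinite_setOf_eval_ne_zero hh (Set.Finite.of_finite_fibers _ hfin ?_)
    rintro _ ⟨u', hu', rfl⟩
    by_contra hB
    set B := {u | h.eval u ≠ 0} ∩ (fun u => Set.range (D.pt u)) ⁻¹' {Set.range (D.pt u')}
    replace hB : B.Infinite := hB
    obtain ⟨hq', hp', -⟩ := hD u' hu'
    obtain ⟨hq₀, hp₀, -⟩ := hD u₀ hu₀
    have hmem : ∀ u ∈ B, ∀ t, ∃ t', ∀ i, ((D.r i).eval u + t * (D.p i).eval u) * D.q.eval u' =
        D.q.eval u * ((D.r i).eval u' + t' * (D.p i).eval u') := by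
      rintro u ⟨hu, hu2⟩ t
      have h1 : D.pt u t ∈ Set.range (D.pt u') := by
        have : Set.range (D.pt u) = Set.range (D.pt u') := hu2
        rw [← this]; exact ⟨t, rfl⟩
      obtain ⟨t', ht'⟩ := h1
      refine ⟨t', fun i => ?_⟩
      have h2 := congrFun ht' i
      simp only [pt] at h2
      rw [div_eq_div_iff hq' (hD u hu).1] at h2
      linear_combination -h2
    have hr : ∀ u, ∀ i j, ((D.r i).eval u * D.q.eval u' - D.q.eval u * (D.r i).eval u') *
        (D.p j).eval u' = ((D.r j).eval u * D.q.eval u' - D.q.eval u * (D.r j).eval u') *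
        (D.p i).eval u' := by
      intro u i j
      have := eval_eq_zero_of_infinite (f :=
        (D.r i * Polynomial.C (D.q.eval u') - D.q * Polynomial.C ((D.r i).eval u')) *
        Polynomial.C ((D.p j).eval u') -
        (D.r j * Polynomial.C (D.q.eval u') - D.q * Polynomial.C ((D.r j).eval u')) *
        Polynomial.C ((D.p i).eval u')) hB (fun u hu => by
          obtain ⟨t', ht'⟩ := hmem u hu 0
          have h1 := ht' i
          have h2 := ht' j
          simp only [Polynomial.eval_sub, Polynomial.eval_mul, Polynomial.eval_C]
          linear_combination (D.p j).eval u' * h1 - (D.p i).eval u' * h2) u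
      simp only [Polynomial.eval_sub, Polynomial.eval_mul, Polynomial.eval_C] at this
      linear_combination this
    have hp : ∀ u, ∀ i j, (D.p i).eval u * (D.p j).eval u' = (D.p j).eval u * (D.p i).eval u' := by
      intro u i j
      have := eval_eq_zero_of_infinite (f :=
        D.p i * Polynomial.C ((D.p j).eval u') - D.p j * Polynomial.C ((D.p i).eval u')) hB
        (fun u hu => by
          obtain ⟨t', ht'⟩ := hmem u hu 0
          obtain ⟨t'', ht''⟩ := hmem u hu 1
          have h1 := ht' i
          have h2 := ht' j
          have h3 := ht'' i
          have h4 := ht'' j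
          simp only [Polynomial.eval_sub, Polynomial.eval_mul, Polynomial.eval_C]
          apply mul_left_cancel₀ hq'
          linear_combination (D.p j).eval u' * (h3 - h1) - (D.p i).eval u' * (h4 - h2)) u
      simp only [Polynomial.eval_sub, Polynomial.eval_mul, Polynomial.eval_C] at this
      linear_combination this
    obtain ⟨κ, hκ⟩ := exists_smul_of_parallel (v := fun i => (D.p i).eval u')
      (w := fun i => (D.p i).eval u₀) (fun h0 => hp₀.elim fun i hi => hi (congrFun h0 i))
      (fun i j => by linear_combination -hp u₀ i j)
    have hex : ∀ u, ∃ c : k, ∀ i, (D.r i).eval u * D.q.eval u' - D.q.eval u * (D.r i).eval u' =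
        c * (D.p i).eval u' := by
      intro u
      obtain ⟨c, hc⟩ := exists_smul_of_parallel
        (v := fun i => (D.r i).eval u * D.q.eval u' - D.q.eval u * (D.r i).eval u')
        (w := fun i => (D.p i).eval u')
        (fun h0 => hp'.elim fun i hi => hi (congrFun h0 i)) (hr u)
      exact ⟨c, fun i => congrFun hc i⟩
    -- Both base points lie on the line of `u'`, at positions given by `c₀` and `c₁`; as `p(u') = κ
    -- p(u₀)`, their difference is a multiple of the direction at `u₀`, which yields the parameter
    -- below.
    obtain ⟨c₀, hc₀⟩ := hex u₀
    obtain ⟨c₁, hc₁⟩ := hex u₁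
    refine hne ((c₁ * D.q.eval u₀ - c₀ * D.q.eval u₁) * κ / (D.q.eval u' * D.q.eval u₁)) ?_
    funext i
    have h1 : (D.p i).eval u' = κ * (D.p i).eval u₀ := congrFun hκ i
    have h2 := hc₀ i
    have h3 := hc₁ i
    simp only [pt]
    rw [h1] at h2 h3
    field_simp
    linear_combination D.q.eval u₀ * h3 - D.q.eval u₁ * h2
  rw [parametrizes_iff hF]
  intro G
  constructor
  · intro hG
    rw [D.mem_vanishingIdeal_iff hh] at hG
    refine dvd_of_infinite_lines hF (hinf.mono ?_)
    rintro _ ⟨u, hu, rfl⟩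
    obtain ⟨hq, hp, hz⟩ := hD u hu
    refine ⟨D.isLine_range_pt hq hp, ?_⟩
    rintro _ ⟨t, rfl⟩
    exact ⟨hz t, hG u t hu hq⟩
  · rintro ⟨G, rfl⟩
    rw [D.mem_vanishingIdeal_iff hh]
    intro u t hu _
    rw [map_mul, (hD u hu).2.2 t, zero_mul]

end RuledForm

end RuledSurface
end

/-! ### Common roots of polynomials at a general specialization. -/

noncomputable section
namespace RuledSurface
open Polynomial

section GenericRoots

variable {k R : Type*} [Field k] [CommRing R] [IsDomain R]

/-- `(FractionRing R)[X]` is the localization of `R[X]` at the nonzero constants of `R`. -/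
theorem exists_mem_map_eq_C_mul {J : Ideal R[X]} {y : (FractionRing R)[X]}
    (hy : y ∈ J.map (mapRingHom (algebraMap R (FractionRing R)))) :
    ∃ d : R, d ≠ 0 ∧ ∃ f ∈ J, f.map (algebraMap R (FractionRing R)) =
      C (algebraMap R (FractionRing R) d) * y := by
  let : Algebra R[X] (FractionRing R)[X] := Polynomial.algebra R (FractionRing R)
  have := Polynomial.isLocalization (nonZeroDivisors R) (FractionRing R)
  have h := (IsLocalization.mem_map_algebraMap_iff
    ((nonZeroDivisors R).map (C : R →+* R[X])) (FractionRing R)[X]).1 hy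
  obtain ⟨⟨f, ⟨_, ⟨d, hd, rfl⟩⟩⟩, h⟩ := h
  refine ⟨d, nonZeroDivisors.ne_zero hd, f, f.2, ?_⟩
  rw [mul_comm]
  have h' : y * ((C d).map (algebraMap R (FractionRing R))) =
    (f : R[X]).map (algebraMap R (FractionRing R)) := h
  rw [← h', map_C]

theorem exists_map_eq_C_mul (y : (FractionRing R)[X]) :
    ∃ d : R, d ≠ 0 ∧ ∃ f : R[X], f.map (algebraMap R (FractionRing R)) =
      C (algebraMap R (FractionRing R) d) * y := by
  obtain ⟨d, hd, f, -, hf⟩ := exists_mem_map_eq_C_mul (J := ⊤) (y := y)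
    (by rw [Ideal.map_top]; trivial)
  exact ⟨d, hd, f, hf⟩

theorem map_algebraMap_fractionRing_injective {R : Type*} [CommRing R] :
    Function.Injective (Polynomial.map (algebraMap R (FractionRing R))) :=
  Polynomial.map_injective _ (IsFractionRing.injective R (FractionRing R))

/-- The common roots of a finitely generated ideal of polynomials over a domain, at a general
specialization of the coefficients: there are none, or there is one depending rationally on the
coefficients, or there are at least two. -/
theorem generic_common_roots [IsAlgClosed k] [CharZero R] {J : Ideal R[X]} (hJ : J.FG) :
    (∃ d : R, d ≠ 0 ∧ ∀ ε : R →+* k, ε d ≠ 0 → ∀ α, ∃ f ∈ J, f.eval₂ ε α ≠ 0) ∨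
    (∃ d p₀ p₁ : R, d ≠ 0 ∧ ∀ ε : R →+* k, ε d ≠ 0 → ε p₁ ≠ 0 ∧
      ∀ f ∈ J, f.eval₂ ε (-ε p₀ / ε p₁) = 0) ∨
    (∃ d : R, d ≠ 0 ∧ ∀ ε : R →+* k, ε d ≠ 0 → ∃ α β, α ≠ β ∧
      ∀ f ∈ J, f.eval₂ ε α = 0 ∧ f.eval₂ ε β = 0) := by
  classical
  set K := FractionRing R
  have : CharZero K := charZero_of_injective_algebraMap (IsFractionRing.injective R K)
  -- Over the fraction field the ideal is generated by one `h`. If `h = 0`, every point is a common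
  -- root and `0` is chosen; if `h` is a unit, `J` contains a nonzero constant. Otherwise the roots
  -- of one irreducible factor of `h` suffice: a rational root in degree one, at least two roots in
  -- higher degree.
  obtain ⟨h, hh⟩ := (IsPrincipalIdealRing.principal
    (J.map (mapRingHom (algebraMap R K)))).principal
  have hmem : ∀ f ∈ J, h ∣ f.map (algebraMap R K) := by
    intro f hf
    rw [← Ideal.mem_span_singleton]
    rw [Ideal.submodule_span_eq] at hh
    rw [← hh]
    exact Ideal.mem_map_of_mem (mapRingHom (algebraMap R K)) hf
  by_cases h0 : h = 0
  · right; left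
    refine ⟨1, 0, 1, one_ne_zero, fun ε _ => ⟨by simp, fun f hf => ?_⟩⟩
    have h1 := hmem f hf
    rw [h0, zero_dvd_iff] at h1
    rw [map_algebraMap_fractionRing_injective (h1.trans (Polynomial.map_zero _).symm), eval₂_zero]
  by_cases hu : IsUnit h
  · left
    have h1 : (1 : K[X]) ∈ J.map (mapRingHom (algebraMap R K)) := by
      rw [hh, Ideal.submodule_span_eq, Ideal.span_singleton_eq_top.2 hu]
      trivial
    obtain ⟨d, hd, f, hf, hfd⟩ := exists_mem_map_eq_C_mul h1
    refine ⟨d, hd, fun ε hε α => ⟨f, hf, ?_⟩⟩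
    have h2 : f = C d := by
      apply map_algebraMap_fractionRing_injective
      rw [hfd, mul_one, map_C]
    rw [h2, eval₂_C]
    exact hε
  right
  obtain ⟨π, hπ, hπh⟩ := WfDvdMonoid.exists_irreducible_factor hu h0
  obtain ⟨c, hc, ϖ, hϖ⟩ := exists_map_eq_C_mul π
  have hcK : IsUnit (C (algebraMap R K c)) :=
    isUnit_C.2 (IsUnit.mk0 _ (by
      intro h
      exact hc (IsFractionRing.injective R K (h.trans (map_zero _).symm))))
  have hassoc : Associated π (ϖ.map (algebraMap R K)) := by
    rw [hϖ]
    exact ⟨hcK.unit, by rw [IsUnit.unit_spec, mul_comm]⟩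
  have hirr : Irreducible (ϖ.map (algebraMap R K)) := hassoc.irreducible hπ
  obtain ⟨T, hT⟩ := hJ
  have hroot : ∀ f ∈ J, ∃ d : R, d ≠ 0 ∧ ∃ g, C d * f = ϖ * g := by
    intro f hf
    obtain ⟨y, hy⟩ := hassoc.symm.dvd.trans (hπh.trans (hmem f hf))
    obtain ⟨d, hd, g, hg⟩ := exists_map_eq_C_mul y
    refine ⟨d, hd, g, map_algebraMap_fractionRing_injective ?_⟩
    rw [Polynomial.map_mul, Polynomial.map_mul, hg, hy, map_C]
    ring
  choose! d hd g hg using hroot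
  have hTJ : ∀ f ∈ T, f ∈ J := fun f hf => hT ▸ Ideal.subset_span hf
  -- `d f` clears the denominator of the quotient of `f` by `ϖ`. One product over the finite
  -- generating set `T` covers all of `J`, because the elements vanishing at `α` under `ε` form an
  -- ideal.
  have hkill : ∀ ε : R →+* k, ε (∏ f ∈ T, d f) ≠ 0 → ∀ α, ϖ.eval₂ ε α = 0 →
      ∀ f ∈ J, f.eval₂ ε α = 0 := by
    intro ε hε α hα
    have hle : J ≤ RingHom.ker (eval₂RingHom ε α) := by
      rw [← hT, Ideal.span_le]
      intro f hf
      have h1 := congrArg (eval₂ ε α) (hg f (hTJ f hf))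
      rw [eval₂_mul, eval₂_mul, hα, zero_mul, eval₂_C] at h1
      rw [map_prod] at hε
      exact (mul_eq_zero.1 h1).resolve_left (Finset.prod_ne_zero_iff.1 hε f hf)
    intro f hf
    exact hle hf
  have hdT : (∏ f ∈ T, d f) ≠ 0 := Finset.prod_ne_zero_iff.2 fun f hf => hd f (hTJ f hf)
  have hdeg : ϖ.natDegree ≠ 0 := by
    have := hirr.natDegree_pos
    rw [natDegree_map_eq_of_injective (IsFractionRing.injective R K)] at this
    omega
  have hlc : ϖ.leadingCoeff ≠ 0 := leadingCoeff_ne_zero.2 fun h => hdeg (by rw [h, natDegree_zero])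
  by_cases h1 : ϖ.natDegree = 1
  · left
    refine ⟨(∏ f ∈ T, d f) * ϖ.leadingCoeff, ϖ.coeff 0, ϖ.coeff 1, mul_ne_zero hdT hlc,
      fun ε hε => ?_⟩
    rw [map_mul] at hε
    have hε1 : ε (ϖ.coeff 1) ≠ 0 := by
      have := right_ne_zero_of_mul hε
      rwa [leadingCoeff, h1] at this
    refine ⟨hε1, hkill ε (left_ne_zero_of_mul hε) _ ?_⟩
    rw [eq_X_add_C_of_natDegree_le_one h1.le]
    simp only [eval₂_add, eval₂_mul, eval₂_C, eval₂_X, coeff_add, coeff_C_mul, coeff_X_zero,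
      coeff_C_zero, coeff_X_one, coeff_C_succ, mul_zero, zero_add, mul_one, add_zero]
    field_simp
    ring
  · right
    obtain ⟨A, B, hAB⟩ := hirr.separable
    obtain ⟨a, ha, A', hA'⟩ := exists_map_eq_C_mul A
    obtain ⟨b, hb, B', hB'⟩ := exists_map_eq_C_mul B
    -- Separability, due to characteristic zero, is written as a Bézout identity over `R`. It
    -- survives specialization when `a * b` does not vanish, and the leading coefficient keeps the
    -- degree at least two, so two distinct roots remain.
    have hbez : C b * A' * ϖ + C a * B' * derivative ϖ = C (a * b) := by
      apply map_algebraMap_fractionRing_injective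
      simp only [Polynomial.map_add, Polynomial.map_mul, hA', hB', map_C, ← derivative_map,
        map_mul]
      linear_combination C (algebraMap R K a) * C (algebraMap R K b) * hAB
    refine ⟨(∏ f ∈ T, d f) * (ϖ.leadingCoeff * (a * b)),
      mul_ne_zero hdT (mul_ne_zero hlc (mul_ne_zero ha hb)), fun ε hε => ?_⟩
    rw [map_mul, map_mul] at hε
    have hε0 := left_ne_zero_of_mul hε
    have hε1 := left_ne_zero_of_mul (right_ne_zero_of_mul hε)
    have hε2 := right_ne_zero_of_mul (right_ne_zero_of_mul hε)
    have hsep : (ϖ.map ε).Separable := by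
      have h2 := congrArg (Polynomial.map ε) hbez
      simp only [Polynomial.map_add, Polynomial.map_mul, map_C, ← derivative_map] at h2
      refine ⟨C (ε (a * b))⁻¹ * (C (ε b) * A'.map ε), C (ε (a * b))⁻¹ * (C (ε a) * B'.map ε), ?_⟩
      have h3 : C (ε (a * b))⁻¹ * C (ε (a * b)) = (1 : k[X]) := by
        rw [← C_mul, inv_mul_cancel₀ hε2, C_1]
      linear_combination C (ε (a * b))⁻¹ * h2 + h3
    have hdegε : (ϖ.map ε).natDegree = ϖ.natDegree := natDegree_map_of_leadingCoeff_ne_zero ε hε1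
    have hcard : 1 < (ϖ.map ε).roots.toFinset.card := by
      rw [Multiset.toFinset_card_of_nodup (nodup_roots hsep),
        ← (IsAlgClosed.splits (ϖ.map ε)).natDegree_eq_card_roots, hdegε]
      omega
    obtain ⟨α, hα, β, hβ, hαβ⟩ := Finset.one_lt_card.1 hcard
    have hev : ∀ α ∈ (ϖ.map ε).roots.toFinset, ϖ.eval₂ ε α = 0 := by
      intro α hα
      rw [Multiset.mem_toFinset] at hα
      have := isRoot_of_mem_roots hα
      rwa [IsRoot, eval_map] at this
    exact ⟨α, β, hαβ, fun f hf => ⟨hkill ε hε0 α (hev α hα) f hf, hkill ε hε0 β (hev β hβ) f hf⟩⟩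

end GenericRoots

end RuledSurface
end

/-! ### Restriction to lines, tangent directions, and lines through a general point. -/

noncomputable section
namespace RuledSurface
open MvPolynomial

section Restriction

variable {k : Type*} [Field k]

/-- The restriction of a polynomial to the line `c + λ v`, as a polynomial in `λ`. -/
def restrict {σ : Type*} (c v : σ → k) (F : MvPolynomial σ k) : Polynomial k :=
  aeval (fun i => Polynomial.C (c i) + Polynomial.C (v i) * Polynomial.X) F

theorem eval_restrict {σ : Type*} (c v : σ → k) (F : MvPolynomial σ k) (τ : k) :
    (restrict c v F).eval τ = eval (c + τ • v) F := by
  have h := map_aeval (fun i => Polynomial.C (c i) + Polynomial.C (v i) * Polynomial.X)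
    (Polynomial.evalRingHom τ) F
  have h1 : (Polynomial.evalRingHom τ).comp (algebraMap k (Polynomial k)) = RingHom.id k := by
    ext x; simp
  rw [h1] at h
  rw [restrict, ← Polynomial.coe_evalRingHom, h]
  simp only [coe_eval₂Hom, Polynomial.coe_evalRingHom, Polynomial.eval_add, Polynomial.eval_C,
    Polynomial.eval_mul, Polynomial.eval_X, eval₂_id]
  congr 2
  funext i
  simp [mul_comm]

theorem derivative_restrict (c v : Fin 3 → k) (F : MvPolynomial (Fin 3) k) :
    Polynomial.derivative (restrict c v F) =
      ∑ i, Polynomial.C (v i) * restrict c v (pderiv i F) := by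
  induction F using MvPolynomial.induction_on with
  | C a => simp [restrict]
  | add p q hp hq =>
    simp only [restrict, map_add] at hp hq ⊢
    rw [hp, hq, ← Finset.sum_add_distrib]
    simp only [mul_add]
  | mul_X p i hp =>
    have hX : restrict c v (X i) = Polynomial.C (c i) + Polynomial.C (v i) * Polynomial.X :=
      aeval_X _ _
    have hmul : ∀ f g, restrict c v (f * g) = restrict c v f * restrict c v g :=
      fun f g => map_mul _ f g
    have hadd : ∀ f g, restrict c v (f + g) = restrict c v f + restrict c v g :=
      fun f g => map_add _ f g
    have hone : ∀ j, restrict c v (pderiv j (X i)) = if j = i then 1 else 0 := by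
      intro j
      split_ifs with hj
      · rw [hj, pderiv_X_self]; exact map_one _
      · rw [pderiv_X_of_ne (Ne.symm hj)]; exact map_zero _
    rw [hmul, Polynomial.derivative_mul, hp, Finset.sum_mul, hX]
    simp only [pderiv_mul, hadd, hmul, hone, hX, mul_add (Polynomial.C _) _ _,
      Finset.sum_add_distrib, Polynomial.derivative_add, Polynomial.derivative_C,
      Polynomial.derivative_C_mul, Polynomial.derivative_X]
    simp only [mul_ite, mul_one, mul_zero, Finset.sum_ite_eq', Finset.mem_univ, if_true,
      zero_add]
    rw [mul_comm (restrict c v p), add_left_inj]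
    exact Finset.sum_congr rfl fun j _ => by ring

theorem restrict_eq_zero_iff [Infinite k] {c v : Fin 3 → k} {F : MvPolynomial (Fin 3) k} :
    restrict c v F = 0 ↔ ∀ τ : k, eval (c + τ • v) F = 0 := by
  constructor
  · intro h τ
    rw [← eval_restrict, h, Polynomial.eval_zero]
  · intro h
    apply Polynomial.funext
    intro τ
    rw [eval_restrict, h, Polynomial.eval_zero]

/-- The direction of a line on a surface is orthogonal to the gradient. -/
theorem sum_pderiv_mul_direction_eq_zero [Infinite k] {c v : Fin 3 → k}
    {F : MvPolynomial (Fin 3) k} (h : ∀ τ : k, eval (c + τ • v) F = 0) (τ : k) :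
    ∑ i, v i * eval (c + τ • v) (pderiv i F) = 0 := by
  have h1 := derivative_restrict c v F
  rw [restrict_eq_zero_iff.2 h, Polynomial.derivative_zero] at h1
  have h2 := congrArg (Polynomial.eval τ) h1
  simp only [Polynomial.eval_zero, Polynomial.eval_finsetSum, Polynomial.eval_mul,
    Polynomial.eval_C, eval_restrict] at h2
  exact h2.symm

/-- The direction of a line on a surface is isotropic for the Hessian. -/
theorem sum_hessian_mul_direction_eq_zero [Infinite k] {c v : Fin 3 → k}
    {F : MvPolynomial (Fin 3) k} (h : ∀ τ : k, eval (c + τ • v) F = 0) (τ : k) :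
    ∑ i, ∑ j, v i * v j * eval (c + τ • v) (pderiv j (pderiv i F)) = 0 := by
  have h1 := derivative_restrict c v F
  rw [restrict_eq_zero_iff.2 h, Polynomial.derivative_zero] at h1
  have h2 := congrArg (fun f => Polynomial.eval τ (Polynomial.derivative f)) h1
  simp only [Polynomial.derivative_zero, Polynomial.eval_zero, Polynomial.derivative_sum,
    Polynomial.derivative_C_mul, derivative_restrict, Polynomial.eval_finsetSum,
    Polynomial.eval_mul, Polynomial.eval_C, eval_restrict, Finset.mul_sum] at h2
  rw [h2]
  exact Finset.sum_congr rfl fun i _ => Finset.sum_congr rfl fun j _ => by ring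

/-- Differentiation lowers the degree in `X j`, so `F` divides a partial derivative only if that
derivative is zero. In characteristic zero a polynomial with all partial derivatives zero is
constant, hence not irreducible. -/
theorem exists_not_dvd_pderiv [CharZero k] {F : MvPolynomial (Fin 3) k} (hF : Irreducible F) :
    ∃ j, ¬ F ∣ pderiv j F := by
  by_contra! hcon
  have hzero : ∀ j, pderiv j F = 0 := by
    intro j
    by_contra hne
    obtain ⟨H, hH⟩ := hcon j
    have hH0 : H ≠ 0 := fun h => hne (by rw [hH, h, mul_zero])
    have h1 : (pderiv j F).degreeOf j = F.degreeOf j + H.degreeOf j := by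
      rw [hH, degreeOf_mul_eq hF.ne_zero hH0]
    have h2 : (pderiv j F).degreeOf j < F.degreeOf j ∨ (pderiv j F) = 0 := by
      by_cases h0 : F.degreeOf j = 0
      · right
        apply pderiv_eq_zero_of_notMem_vars
        intro hj
        obtain ⟨m, hm, hmj⟩ := (mem_vars_iff_mem_support j).1 hj
        have h3 := monomial_le_degreeOf j hm
        exact (Finsupp.mem_support_iff.1 hmj) (by omega)
      · left
        rw [degreeOf_lt_iff (Nat.pos_of_ne_zero h0)]
        intro m hm
        rw [mem_support_iff, coeff_pderiv] at hm
        have h3 := monomial_le_degreeOf j (mem_support_iff.2 (left_ne_zero_of_mul hm))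
        simp only [Finsupp.add_apply, Finsupp.single_eq_same] at h3
        omega
    rcases h2 with h2 | h2
    · omega
    · exact hne h2
  have hconst : F = C (coeff 0 F) := by
    ext m
    rw [coeff_C]
    split_ifs with hm
    · rw [hm]
    · obtain ⟨j, hj⟩ := Finsupp.ne_iff.1 (Ne.symm hm)
      have h1 := congrArg (coeff (m - Finsupp.single j 1)) (hzero j)
      rw [coeff_pderiv, coeff_zero, mul_eq_zero] at h1
      have hle : Finsupp.single j 1 ≤ m := by
        rw [Finsupp.single_le_iff]
        exact Nat.one_le_iff_ne_zero.2 hj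
      rw [tsub_add_cancel_of_le hle] at h1
      refine h1.resolve_right ?_
      exact Nat.cast_add_one_ne_zero _
  apply hF.not_isUnit
  rw [hconst]
  refine (isUnit_iff_ne_zero.2 ?_).map C
  intro h0
  rw [h0, C_0] at hconst
  exact hF.ne_zero hconst

theorem eval_line_eq_zero_of_smul {x v w : Fin 3 → k} {F : MvPolynomial (Fin 3) k}
    (h : ∀ τ : k, eval (x + τ • v) F = 0) {c : k} (hw : w = c • v) (τ : k) :
    eval (x + τ • w) F = 0 := by
  rw [hw, smul_smul]
  exact h _

end Restriction

section Tangent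

/-- The vector orthogonal to `n` with coordinates proportional to `α`, `β` at the indices `a`, `b`;
all other indices are supposed to be equal to `j`. -/
def tangent {A : Type*} [CommRing A] (n : Fin 3 → A) (a b j : Fin 3) (α β : A) : Fin 3 → A :=
  fun i => if i = a then α * n j else if i = b then β * n j else -(α * n a + β * n b)

theorem map_tangent {A B : Type*} [CommRing A] [CommRing B] (φ : A →+* B) (n : Fin 3 → A)
    (a b j : Fin 3) (α β : A) (i : Fin 3) :
    φ (tangent n a b j α β i) = tangent (fun i => φ (n i)) a b j (φ α) (φ β) i := by
  simp only [tangent, apply_ite φ, map_mul, map_neg, map_add]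

theorem exists_other_indices (j : Fin 3) : ∃ a b : Fin 3, a ≠ b ∧ a ≠ j ∧ b ≠ j ∧
    ∀ i, i = a ∨ i = b ∨ i = j := by
  revert j; decide

theorem sum_eq_of_indices {A : Type*} [AddCommMonoid A] {a b j : Fin 3} (hab : a ≠ b)
    (haj : a ≠ j) (hbj : b ≠ j) (hall : ∀ i, i = a ∨ i = b ∨ i = j) (f : Fin 3 → A) :
    ∑ i, f i = f a + f b + f j := by
  have hu : (Finset.univ : Finset (Fin 3)) = {a, b, j} := by
    ext i; simpa using hall i
  rw [hu, Finset.sum_insert (by simp [hab, haj]), Finset.sum_insert (by simp [hbj]),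
    Finset.sum_singleton, add_assoc]

/-- When `n j ≠ 0`, a tangent vector is determined by its coordinates at `a` and `b`, so tangent
directions form a pencil with coordinates `(v a : v b)`. -/
theorem smul_eq_tangent {k : Type*} [Field k] {n v : Fin 3 → k} {a b j : Fin 3} (hab : a ≠ b)
    (haj : a ≠ j) (hbj : b ≠ j) (hall : ∀ i, i = a ∨ i = b ∨ i = j) (h : ∑ i, v i * n i = 0) :
    n j • v = tangent n a b j (v a) (v b) := by
  have hsum : v a * n a + v b * n b + v j * n j = 0 := by
    rw [← h, sum_eq_of_indices hab haj hbj hall]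
  funext i
  rcases hall i with rfl | rfl | rfl
  · simp [tangent, mul_comm]
  · simp [tangent, hab.symm, mul_comm]
  · simp only [Pi.smul_apply, smul_eq_mul, tangent, haj.symm, hbj.symm, if_false]
    linear_combination hsum

/-- At the general points of a surface covered by lines, either there is a line whose direction
depends rationally on the point, or there are two different lines. -/
theorem generic_directions {k : Type*} [Field k] [IsAlgClosed k] [CharZero k]
    {F : MvPolynomial (Fin 3) k} (hF : Irreducible F)
    (hruled : ∀ x, eval x F = 0 → ∃ v : Fin 3 → k, v ≠ 0 ∧ ∀ τ : k, eval (x + τ • v) F = 0) :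
    (∃ (V : Fin 3 → MvPolynomial (Fin 3) k) (g : MvPolynomial (Fin 3) k), ¬ F ∣ g ∧
      ∀ x, eval x F = 0 → eval x g ≠ 0 → (∃ i, eval x (V i) ≠ 0) ∧
        ∀ τ : k, eval (x + τ • fun i => eval x (V i)) F = 0) ∨
    (∃ g : MvPolynomial (Fin 3) k, ¬ F ∣ g ∧ ∀ x, eval x F = 0 → eval x g ≠ 0 →
      ∃ v w : Fin 3 → k, (∃ i j, v i * w j ≠ v j * w i) ∧
        (∀ τ : k, eval (x + τ • v) F = 0) ∧ ∀ τ : k, eval (x + τ • w) F = 0) := by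
  obtain ⟨j, hj⟩ := exists_not_dvd_pderiv hF
  obtain ⟨a, b, hab, haj, hbj, hall⟩ := exists_other_indices j
  have hprime : (Ideal.span {F}).IsPrime :=
    (Ideal.span_singleton_prime hF.ne_zero).2 hF.prime
  let R := MvPolynomial (Fin 3) k ⧸ Ideal.span {F}
  let mk : MvPolynomial (Fin 3) k →+* R := Ideal.Quotient.mk _
  have : IsDomain R := inferInstanceAs (IsDomain (MvPolynomial (Fin 3) k ⧸ Ideal.span {F}))
  have : CharZero R := charZero_of_injective_algebraMap (algebraMap k R).injective
  have hmk : ∀ f, mk f ≠ 0 → ¬ F ∣ f := fun f hf h =>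
    hf (Ideal.Quotient.eq_zero_iff_mem.2 (Ideal.mem_span_singleton.2 h))
  have hε : ∀ x, eval x F = 0 → ∃ ε : R →+* k, ∀ f, ε (mk f) = eval x f := by
    intro x hx
    refine ⟨Ideal.Quotient.lift _ (eval x) ?_, fun f => Ideal.Quotient.lift_mk _ _ _⟩
    intro f hf
    obtain ⟨h, rfl⟩ := Ideal.mem_span_singleton.1 hf
    rw [map_mul, hx, zero_mul]
  let n : Fin 3 → MvPolynomial (Fin 3) k := fun i => pderiv i F
  -- `V` is the universal tangent direction with coordinates `(α : 1)`, the unknown `α` being the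
  -- variable over the coordinate ring. The common roots of all `G τ` at `x` are the `α` whose line
  -- lies on the surface.
  let V : Fin 3 → Polynomial R :=
    tangent (fun i => Polynomial.C (mk (n i))) a b j Polynomial.X 1
  let G : k → Polynomial R := fun τ =>
    aeval (fun i => Polynomial.C (mk (X i)) + Polynomial.C (mk (C τ)) * V i) F
  have hG : ∀ x (ε : R →+* k), (∀ f, ε (mk f) = eval x f) → ∀ τ α,
      (G τ).eval₂ ε α = eval (x + τ • tangent (fun i => eval x (n i)) a b j α 1) F := by
    intro x ε hεx τ α
    have h1 : (Polynomial.eval₂RingHom ε α).comp (algebraMap k (Polynomial R)) = RingHom.id k := by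
      ext c
      have : algebraMap k (Polynomial R) c = Polynomial.C (mk (C c)) := rfl
      rw [RingHom.comp_apply, this, Polynomial.coe_eval₂RingHom, Polynomial.eval₂_C, hεx, eval_C]
      rfl
    have h2 := map_aeval (fun i => Polynomial.C (mk (X i)) + Polynomial.C (mk (C τ)) * V i)
      (Polynomial.eval₂RingHom ε α) F
    rw [h1] at h2
    rw [← Polynomial.coe_eval₂RingHom, h2, coe_eval₂Hom, eval₂_id]
    congr 2
    funext i
    have hVi : Polynomial.eval₂RingHom ε α (V i) = _ :=
      map_tangent (Polynomial.eval₂RingHom ε α) (fun i => Polynomial.C (mk (n i))) a b j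
        Polynomial.X 1 i
    rw [map_add, map_mul, hVi]
    simp only [Polynomial.coe_eval₂RingHom, Polynomial.eval₂_C, hεx, eval_X, eval_C,
      Polynomial.eval₂_X, Polynomial.eval₂_one]
    rfl
  let J : Ideal (Polynomial R) := Ideal.span (Set.range G)
  have hJ : ∀ x (ε : R →+* k), (∀ f, ε (mk f) = eval x f) → ∀ α, (∀ f ∈ J, f.eval₂ ε α = 0) ↔
      ∀ τ : k, eval (x + τ • tangent (fun i => eval x (n i)) a b j α 1) F = 0 := by
    intro x ε hεx α
    constructor
    · intro h τ
      rw [← hG x ε hεx]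
      exact h _ (Ideal.subset_span ⟨τ, rfl⟩)
    · intro h
      have hle : J ≤ RingHom.ker (Polynomial.eval₂RingHom ε α) := by
        rw [Ideal.span_le]
        rintro _ ⟨τ, rfl⟩
        exact (hG x ε hεx τ α).trans (h τ)
      exact fun f hf => hle hf
  have hJfg : J.FG := IsNoetherian.noetherian J
  rcases generic_common_roots (k := k) hJfg with ⟨d, hd, H⟩ | ⟨d, p₀, p₁, hd, H⟩ | ⟨d, hd, H⟩
  · obtain ⟨g, rfl⟩ := Ideal.Quotient.mk_surjective d
    left
    refine ⟨tangent n a b j 1 0, g * n j, fun h => (hF.prime.dvd_or_dvd h).elim (hmk _ hd) hj,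
      fun x hx hgx => ?_⟩
    rw [map_mul] at hgx
    have hnj := right_ne_zero_of_mul hgx
    obtain ⟨ε, hεx⟩ := hε x hx
    have hV : (fun i => eval x (tangent n a b j 1 0 i)) =
        tangent (fun i => eval x (n i)) a b j 1 0 := by
      funext i
      rw [map_tangent, map_one, map_zero]
    rw [hV]
    refine ⟨⟨a, ?_⟩, ?_⟩
    · rw [map_tangent]
      simpa [tangent] using hnj
    obtain ⟨v, hv, hline⟩ := hruled x hx
    have horth := sum_pderiv_mul_direction_eq_zero hline 0
    simp only [zero_smul, add_zero] at horth
    have hvt := smul_eq_tangent (n := fun i => eval x (n i)) hab haj hbj hall horth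
    -- There is a line through `x`, but none in the chart `(α : 1)`; its direction must be the
    -- remaining one `(1 : 0)`, which depends polynomially on `x`.
    have hvb : v b = 0 := by
      by_contra hvb
      obtain ⟨f, hf, hfne⟩ := H ε (by rw [show ε _ = _ from hεx g]; exact left_ne_zero_of_mul hgx)
        (v a / v b)
      refine hfne ((hJ x ε hεx (v a / v b)).2 (fun τ => ?_) f hf)
      refine eval_line_eq_zero_of_smul hline (c := (v b)⁻¹ * eval x (n j)) ?_ τ
      rw [mul_smul, hvt]
      funext i
      simp only [tangent, Pi.smul_apply, smul_eq_mul]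
      split_ifs <;> field_simp
    have hva : v a ≠ 0 := by
      intro hva
      apply hv
      have h1 : eval x (n j) • v = 0 := by
        rw [hvt, hva, hvb]
        funext i
        simp [tangent]
      exact (smul_eq_zero.1 h1).resolve_left hnj
    intro τ
    refine eval_line_eq_zero_of_smul hline (c := (v a)⁻¹ * eval x (n j)) ?_ τ
    rw [mul_smul, hvt, hvb]
    funext i
    simp only [tangent, Pi.smul_apply, smul_eq_mul]
    split_ifs <;> field_simp <;> ring
  · obtain ⟨g, rfl⟩ := Ideal.Quotient.mk_surjective d
    obtain ⟨p₀, rfl⟩ := Ideal.Quotient.mk_surjective p₀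
    obtain ⟨p₁, rfl⟩ := Ideal.Quotient.mk_surjective p₁
    left
    refine ⟨tangent n a b j (-p₀) p₁, g * n j,
      fun h => (hF.prime.dvd_or_dvd h).elim (hmk _ hd) hj, fun x hx hgx => ?_⟩
    rw [map_mul] at hgx
    have hnj := right_ne_zero_of_mul hgx
    obtain ⟨ε, hεx⟩ := hε x hx
    obtain ⟨hp₁, hroot⟩ := H ε (by
      rw [show ε _ = _ from hεx g]; exact left_ne_zero_of_mul hgx)
    rw [hJ x ε hεx, show ε _ = _ from hεx p₀, show ε _ = _ from hεx p₁] at hroot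
    rw [show ε _ = _ from hεx p₁] at hp₁
    have hV : (fun i => eval x (tangent n a b j (-p₀) p₁ i)) =
        tangent (fun i => eval x (n i)) a b j (-eval x p₀) (eval x p₁) := by
      funext i
      rw [map_tangent, map_neg]
    rw [hV]
    refine ⟨⟨b, ?_⟩, fun τ => eval_line_eq_zero_of_smul hroot (c := eval x p₁) ?_ τ⟩
    · rw [map_tangent]
      simpa [tangent, hab.symm] using ⟨hp₁, hnj⟩
    · funext i
      simp only [tangent, Pi.smul_apply, smul_eq_mul]
      split_ifs <;> field_simp
  · obtain ⟨g, rfl⟩ := Ideal.Quotient.mk_surjective d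
    right
    refine ⟨g * n j, fun h => (hF.prime.dvd_or_dvd h).elim (hmk _ hd) hj, fun x hx hgx => ?_⟩
    rw [map_mul] at hgx
    have hnj := right_ne_zero_of_mul hgx
    obtain ⟨ε, hεx⟩ := hε x hx
    obtain ⟨α, β, hαβ, hroot⟩ := H ε (by
      rw [show ε _ = _ from hεx g]; exact left_ne_zero_of_mul hgx)
    refine ⟨_, _, ⟨a, b, ?_⟩, (hJ x ε hεx α).1 fun f hf => (hroot f hf).1,
      (hJ x ε hεx β).1 fun f hf => (hroot f hf).2⟩
    simp only [tangent, hab.symm, if_true, if_false, one_mul]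
    intro h
    apply hαβ
    apply mul_right_cancel₀ (mul_ne_zero hnj hnj)
    linear_combination h

end Tangent

end RuledSurface
end

/-! ### Ruled parametrization from a rational field of directions. -/

noncomputable section
namespace RuledSurface
open MvPolynomial

section RationalDirection

variable {k : Type*} [Field k]

/-- A surface is not contained in a line. -/
theorem exists_linear_form_not_dvd {F : MvPolynomial (Fin 3) k} {x v : Fin 3 → k} (hv : v ≠ 0)
    (hx : eval x F = 0) : ∃ i j, ¬ F ∣ (X i - C (x i)) * C (v j) - (X j - C (x j)) * C (v i) := by
  by_contra! hcon
  obtain ⟨m, hm⟩ := Function.ne_iff.1 hv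
  have hm' : v m ≠ 0 := hm
  obtain ⟨a, b, hab, ham, hbm, -⟩ := exists_other_indices m
  -- At the zero `x` of `F`, the gradient of a multiple of `F` is a multiple of the gradient of `F`.
  -- The linear forms for `(a, m)` and `(b, m)` have linearly independent gradients, so they cannot
  -- both be multiples.
  have hder : ∀ i, ∃ c : k, ∀ l, c * eval x (pderiv l F) =
      (if i = l then 1 else 0) * v m - (if m = l then 1 else 0) * v i := by
    intro i
    obtain ⟨H, hH⟩ := hcon i m
    refine ⟨eval x H, fun l => ?_⟩
    have h1 := congrArg (fun f => eval x (pderiv l f)) hH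
    simp only [map_sub, pderiv_mul, pderiv_C, map_add, map_mul, hx, mul_zero,
      sub_zero, add_zero, zero_mul, eval_C] at h1
    rw [mul_comm, ← h1]
    congr 2
    · split_ifs with h
      · rw [h, pderiv_X_self, map_one]
      · rw [pderiv_X_of_ne h, map_zero]
    · split_ifs with h
      · rw [h, pderiv_X_self, map_one]
      · rw [pderiv_X_of_ne h, map_zero]
  obtain ⟨c, hc⟩ := hder a
  obtain ⟨d, hd⟩ := hder b
  have h1 := hc a
  have h2 := hc b
  have h3 := hd b
  simp only [if_true, if_neg hab, if_neg ham.symm, if_neg hbm.symm, one_mul, zero_mul,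
    sub_zero, mul_eq_zero] at h1 h2 h3
  rcases h2 with h2 | h2
  · rw [h2, zero_mul] at h1
    exact hm' h1.symm
  · rw [h2, mul_zero] at h3
    exact hm' h3.symm

/-- A unirational surface with a line through its general point whose direction depends rationally
on the point has a parametrization in ruled form. -/
theorem exists_ruledForm_of_direction [IsAlgClosed k] {F : MvPolynomial (Fin 3) k} (hF : Irreducible F)
    {P : Fin 3 → FunctionField k} (hP : Parametrizes P {x | eval x F = 0})
    (V : Fin 3 → MvPolynomial (Fin 3) k) {g : MvPolynomial (Fin 3) k} (hg : ¬ F ∣ g)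
    (hV : ∀ x, eval x F = 0 → eval x g ≠ 0 → (∃ i, eval x (V i) ≠ 0) ∧
      ∀ τ : k, eval (x + τ • fun i => eval x (V i)) F = 0) :
    ∃ D : RuledForm k, Parametrizes D.toMap {x | eval x F = 0} ∧ ∃ i, D.p i ≠ 0 := by
  obtain ⟨a, b, hb, hab⟩ := exists_common_denominator P
  let pt : (Fin 2 → k) → Fin 3 → k := fun z i => eval z (a i) / eval z b
  have hptS : ∀ z, eval z b ≠ 0 → eval (pt z) F = 0 := fun z hz =>
    hP.image_subset ⟨z, hasValueAt_of_common_denominator hab hz⟩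
  have hpoint : ∀ f, ¬ F ∣ f → ∃ z, eval z b ≠ 0 ∧ eval (pt z) f ≠ 0 := by
    intro f hf
    by_contra! hcon
    refine hf (((parametrizes_iff hF).1 hP f).1 ?_)
    rw [mem_vanishingIdeal_image_iff hb one_ne_zero hab]
    exact fun z _ hz => hcon z hz
  obtain ⟨z₀, hz₀, hgz₀⟩ := hpoint g hg
  obtain ⟨hv, -⟩ := hV _ (hptS z₀ hz₀) hgz₀
  set v : Fin 3 → k := fun i => eval (pt z₀) (V i) with hvdef
  have hv0 : v ≠ 0 := fun h => hv.elim fun i hi => hi (congrFun h i)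
  obtain ⟨i₁, j₁, hij⟩ := exists_linear_form_not_dvd hv0 (hptS z₀ hz₀)
  -- `P(z₁)` is off the line attached to `P(z₀)`. The curve `u ↦ P(z₀ + u (z₁ - z₀))` thus carries a
  -- nonconstant family of lines.
  obtain ⟨z₁, hz₁, hne⟩ := hpoint _ hij
  simp only [map_sub, map_mul, eval_X, eval_C] at hne
  let A : Fin 3 → Polynomial k := fun i => restrict z₀ (z₁ - z₀) (a i)
  let B : Polynomial k := restrict z₀ (z₁ - z₀) b
  let z : k → Fin 2 → k := fun u => z₀ + u • (z₁ - z₀)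
  have hA : ∀ u i, (A i).eval u = eval (z u) (a i) := fun u i => eval_restrict _ _ _ _
  have hB : ∀ u, B.eval u = eval (z u) b := fun u => eval_restrict _ _ _ _
  have hz0 : z 0 = z₀ := by simp [z]
  have hz1 : z 1 = z₁ := by simp [z]
  choose N hN using fun f : MvPolynomial (Fin 3) k => exists_clear_denominators A B f
  let M := (∑ i, N (V i)) + N g
  have hW : ∀ f, N f ≤ M → ∃ W : Polynomial k, ∀ u, B.eval u ≠ 0 →
      W.eval u = B.eval u ^ M * eval (pt (z u)) f := by
    intro f hf
    obtain ⟨W, hW⟩ := hN f M hf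
    refine ⟨W, fun u hu => ?_⟩
    have h1 := hW k (Polynomial.aeval u) (by simpa using hu)
    simp only [Polynomial.coe_aeval_eq_eval, aeval_eq_eval] at h1
    rw [h1]
    congr 3
    funext i
    rw [hA, hB]
  choose W hW' using fun i => hW (V i) ((Finset.single_le_sum (f := fun i => N (V i))
    (fun _ _ => Nat.zero_le _) (Finset.mem_univ i)).trans (Nat.le_add_right _ _))
  obtain ⟨Wg, hWg⟩ := hW g (Nat.le_add_left _ _)
  have hB0 : B ≠ 0 := by
    intro h
    apply hz₀
    rw [← hz0, ← hB, h, Polynomial.eval_zero]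
  let D : RuledForm k := ⟨A, W, B, hB0⟩
  have hpt : ∀ u t, B.eval u ≠ 0 → D.pt u t = pt (z u) +
      (t * B.eval u ^ M / B.eval u) • fun i => eval (pt (z u)) (V i) := by
    intro u t hu
    funext i
    simp only [RuledForm.pt, D, Pi.add_apply, Pi.smul_apply, smul_eq_mul, hW' i u hu, hA, pt]
    rw [hB]
    ring
  have hBz₀ : B.eval 0 ≠ 0 := by rwa [hB, hz0]
  have hBz₁ : B.eval 1 ≠ 0 := by rwa [hB, hz1]
  have hh0 : (Wg * B).eval 0 ≠ 0 := by
    rw [Polynomial.eval_mul, hWg 0 hBz₀, hz0]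
    exact mul_ne_zero (mul_ne_zero (pow_ne_zero _ hBz₀) hgz₀) hBz₀
  have hD : ∀ u, (Wg * B).eval u ≠ 0 → D.q.eval u ≠ 0 ∧ (∃ i, (D.p i).eval u ≠ 0) ∧
      ∀ t, eval (D.pt u t) F = 0 := by
    intro u hu
    rw [Polynomial.eval_mul] at hu
    have hBu := right_ne_zero_of_mul hu
    have hgu : eval (pt (z u)) g ≠ 0 := by
      have := left_ne_zero_of_mul hu
      rw [hWg u hBu] at this
      exact right_ne_zero_of_mul this
    obtain ⟨⟨i, hi⟩, hline⟩ := hV _ (hptS (z u) (by rwa [← hB])) hgu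
    refine ⟨hBu, ⟨i, ?_⟩, fun t => ?_⟩
    · change (W i).eval u ≠ 0
      rw [hW' i u hBu]
      exact mul_ne_zero (pow_ne_zero _ hBu) hi
    · rw [hpt u t hBu]
      exact hline _
  refine ⟨D, D.parametrizes_of_lines hF (Wg * B) hD hh0 (u₁ := 1) hBz₁ ?_, ?_⟩
  · intro t ht
    rw [hpt 1 0 hBz₁, hpt 0 t hBz₀, hz0, hz1, zero_mul, zero_div, zero_smul, add_zero] at ht
    apply hne
    rw [ht]
    simp only [Pi.add_apply, Pi.smul_apply, smul_eq_mul, hvdef]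
    ring
  · obtain ⟨-, ⟨i, hi⟩, -⟩ := hD 0 hh0
    exact ⟨i, fun h => hi (by rw [h, Polynomial.eval_zero])⟩

end RationalDirection

end RuledSurface
end

/-! ### Surfaces with two lines through a general point. -/

noncomputable section
namespace RuledSurface
open MvPolynomial

section TwoLines

variable {k : Type*} [Field k]

theorem pderiv_pderiv_comm {σ : Type*} (i j : σ) (F : MvPolynomial σ k) :
    pderiv i (pderiv j F) = pderiv j (pderiv i F) := by
  classical
  by_cases hij : i = j
  · rw [hij]
  ext m
  simp only [coeff_pderiv, Finsupp.add_apply, Finsupp.single_apply, if_neg hij,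
    if_neg (Ne.symm hij), add_zero]
  rw [add_right_comm]
  ring

/-- Polynomials with vanishing Wronskian are proportional. -/
theorem exists_eq_C_mul_of_wronskian [CharZero k] {f g : Polynomial k} {u : k}
    (hg : g.eval u ≠ 0)
    (h : Polynomial.derivative f * g = f * Polynomial.derivative g) :
    ∃ c, f = Polynomial.C c * g := by
  refine ⟨f.eval u / g.eval u, ?_⟩
  set c := f.eval u / g.eval u with hc
  set e := f - Polynomial.C c * g with he
  have hg0 : g ≠ 0 := fun h0 => hg (by rw [h0, Polynomial.eval_zero])
  have hroot : e.IsRoot u := by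
    simp only [he, Polynomial.IsRoot, Polynomial.eval_sub, Polynomial.eval_mul, Polynomial.eval_C,
      hc]
    field_simp
    ring
  have hW : Polynomial.derivative e * g = e * Polynomial.derivative g := by
    simp only [he, Polynomial.derivative_sub, Polynomial.derivative_C_mul]
    linear_combination h
  rw [← sub_eq_zero]
  change e = 0
  by_contra hne
  -- `e' g = e g'` is impossible for nonzero `e`: the order at `u` is one less than that of `e` on
  -- the left, since `g(u) ≠ 0`, and at least that of `e` on the right.
  have hm : 0 < e.rootMultiplicity u := (Polynomial.rootMultiplicity_pos hne).2 hroot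
  have hd : (Polynomial.derivative e).rootMultiplicity u = e.rootMultiplicity u - 1 :=
    Polynomial.derivative_rootMultiplicity_of_root hroot
  have hd0 : Polynomial.derivative e ≠ 0 := by
    intro h0
    have h1 := Polynomial.derivative_eq_zero.1 h0
    obtain ⟨a, ha⟩ := Polynomial.natDegree_eq_zero.1 h1
    rw [← ha, Polynomial.IsRoot, Polynomial.eval_C] at hroot
    rw [hroot, Polynomial.C_0] at ha
    exact hne ha.symm
  have hl0 : Polynomial.derivative e * g ≠ 0 := mul_ne_zero hd0 hg0
  have hr0 : e * Polynomial.derivative g ≠ 0 := hW ▸ hl0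
  have h1 := Polynomial.rootMultiplicity_mul (x := u) hl0
  rw [hW, Polynomial.rootMultiplicity_mul hr0, hd,
    Polynomial.rootMultiplicity_eq_zero (p := g) (x := u) hg] at h1
  omega

/-- `tangent n a b j 0 1` and `w` span the tangent plane. Subtracting a multiple of `w` kills the
`a`-coordinate of `v`, and what is left is a nonzero multiple of the first vector. -/
theorem exists_smul_eq_tangent_add_smul {n v w : Fin 3 → k} {a b j : Fin 3} (hab : a ≠ b)
    (haj : a ≠ j) (hbj : b ≠ j) (hall : ∀ i, i = a ∨ i = b ∨ i = j)
    (hnj : n j ≠ 0) (hv : ∑ i, v i * n i = 0) (hw : ∑ i, w i * n i = 0) (hwa : w a ≠ 0)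
    (hvw : ∃ i l, v i * w l ≠ v l * w i) :
    ∃ c θ : k, tangent n a b j 0 1 + θ • w = c • v := by
  have hz := smul_eq_tangent (n := n) (v := v - (v a / w a) • w) hab haj hbj hall (by
    simp only [Pi.sub_apply, Pi.smul_apply, smul_eq_mul, sub_mul, mul_assoc,
      Finset.sum_sub_distrib, ← Finset.mul_sum, hv, hw]
    ring)
  have hza : (v - (v a / w a) • w) a = 0 := by
    simp [hwa]
  set z := v - (v a / w a) • w with hzdef
  rw [hza] at hz
  have hzb : z b ≠ 0 := by
    intro hzb
    have h0 : n j • z = 0 := by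
      rw [hz, hzb]
      funext i
      simp [tangent]
    have h1 : v = (v a / w a) • w := sub_eq_zero.1 ((smul_eq_zero.1 h0).resolve_left hnj)
    obtain ⟨i, l, hil⟩ := hvw
    apply hil
    rw [h1]
    simp only [Pi.smul_apply, smul_eq_mul]
    ring
  refine ⟨n j / z b, n j / z b * (v a / w a), ?_⟩
  have h1 : tangent n a b j 0 1 = (z b)⁻¹ • (n j • z) := by
    rw [hz]
    funext i
    simp only [tangent, Pi.smul_apply, smul_eq_mul]
    split_ifs <;> field_simp <;> ring
  rw [h1, hzdef]
  funext i
  simp only [Pi.add_apply, Pi.smul_apply, Pi.sub_apply, smul_eq_mul]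
  ring

/-- A vector orthogonal to `w` and to `tangent n a b j 0 1` is proportional to `n`. -/
theorem mul_eq_mul_of_orthogonal {A : Type*} [CommRing A] [IsDomain A] {n m w : Fin 3 → A}
    {a b j : Fin 3} (hab : a ≠ b) (haj : a ≠ j) (hbj : b ≠ j)
    (hall : ∀ i, i = a ∨ i = b ∨ i = j) (hwa : w a ≠ 0) (hn : ∑ i, w i * n i = 0)
    (hm : ∑ i, w i * m i = 0) (hmu : ∑ i, tangent n a b j 0 1 i * m i = 0) (i : Fin 3) :
    m i * n j = n i * m j := by
  have hsum := sum_eq_of_indices (A := A) hab haj hbj hall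
  rw [hsum] at hn hm hmu
  simp only [tangent, if_true, if_neg hab.symm, if_neg haj.symm, if_neg hbj.symm] at hmu
  rcases hall i with rfl | rfl | rfl
  · apply mul_left_cancel₀ hwa
    linear_combination n j * hm - m j * hn - w b * hmu
  · linear_combination hmu
  · ring

/-- A surface whose equation divides a linear form is a plane, so it is covered by parallel
lines. -/
theorem exists_constant_direction [Infinite k] {F : MvPolynomial (Fin 3) k} {c x : Fin 3 → k}
    {a b j : Fin 3} (hab : a ≠ b) (haj : a ≠ j) (hbj : b ≠ j)
    (hall : ∀ i, i = a ∨ i = b ∨ i = j) (hcj : c j = 1)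
    (hdvd : F ∣ ∑ i, C (c i) * (X i - C (x i))) :
    ∃ e : Fin 3 → k, (∃ i, e i ≠ 0) ∧ ∀ y, eval y F = 0 → ∀ τ : k, eval (y + τ • e) F = 0 := by
  obtain ⟨H, hH⟩ := hdvd
  have hsum := sum_eq_of_indices (A := k) hab haj hbj hall
  refine ⟨tangent c a b j 0 1, ⟨b, by simp [tangent, hab.symm, hcj]⟩, fun y hy => ?_⟩
  have hl : ∀ z, eval z (F * H) = ∑ i, c i * (z i - x i) := by
    intro z
    rw [← hH]
    simp
  -- If `F` and `H` both vanished at `y`, all partial derivatives of the linear form would vanish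
  -- there, but the `j`-th is `c j = 1`. Hence `F`, not `H`, vanishes on the line through `y`.
  have hHy : eval y H ≠ 0 := by
    intro hHy
    have h1 := congrArg (fun f => eval y (pderiv j f)) hH
    simp only [map_sum, pderiv_mul, pderiv_C, map_sub, map_add, map_mul, hy, hHy, zero_mul,
      sub_zero, zero_add, eval_C, mul_zero, add_zero] at h1
    rw [hsum, pderiv_X_of_ne haj, pderiv_X_of_ne hbj, pderiv_X_self, hcj] at h1
    simp at h1
  have hprod : restrict y (tangent c a b j 0 1) F * restrict y (tangent c a b j 0 1) H = 0 := by
    have h1 : restrict y (tangent c a b j 0 1) F * restrict y (tangent c a b j 0 1) H =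
        restrict y (tangent c a b j 0 1) (F * H) := (map_mul _ F H).symm
    rw [h1, restrict_eq_zero_iff]
    intro τ
    have h2 := hl y
    rw [map_mul, hy, zero_mul, hsum] at h2
    rw [hl, hsum]
    simp only [Pi.add_apply, Pi.smul_apply, smul_eq_mul, tangent, if_true, if_neg hab.symm,
      if_neg haj.symm, if_neg hbj.symm]
    linear_combination -h2
  rcases mul_eq_zero.1 hprod with h | h
  · exact restrict_eq_zero_iff.1 h
  · exfalso
    apply hHy
    have := restrict_eq_zero_iff.1 h 0
    simpa using this

/-- If there are two lines through the general point of a surface, then the lines meeting a general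
line of the surface form a ruled parametrization, unless the surface is a plane. -/
theorem exists_ruledForm_of_two_lines [IsAlgClosed k] [CharZero k] {F : MvPolynomial (Fin 3) k}
    (hF : Irreducible F)
    (hruled : ∀ x, eval x F = 0 → ∃ v : Fin 3 → k, v ≠ 0 ∧ ∀ τ : k, eval (x + τ • v) F = 0)
    {g : MvPolynomial (Fin 3) k} (hg : ¬ F ∣ g)
    (htwo : ∀ x, eval x F = 0 → eval x g ≠ 0 →
      ∃ v w : Fin 3 → k, (∃ i j, v i * w j ≠ v j * w i) ∧
        (∀ τ : k, eval (x + τ • v) F = 0) ∧ ∀ τ : k, eval (x + τ • w) F = 0) :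
    (∃ D : RuledForm k, Parametrizes D.toMap {x | eval x F = 0} ∧ ∃ i, D.p i ≠ 0) ∨
    ∃ e : Fin 3 → k, (∃ i, e i ≠ 0) ∧ ∀ y, eval y F = 0 → ∀ τ : k, eval (y + τ • e) F = 0 := by
  obtain ⟨j, hj⟩ := exists_not_dvd_pderiv hF
  have hgj : ¬ F ∣ g * pderiv j F := fun h => (hF.prime.dvd_or_dvd h).elim hg hj
  obtain ⟨x, hx, hgx⟩ : ∃ x, eval x F = 0 ∧ eval x (g * pderiv j F) ≠ 0 := by
    by_contra! hcon
    exact hgj ((dvd_iff_forall_eval_eq_zero hF).2 hcon)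
  obtain ⟨w, hw, hwline⟩ := hruled x hx
  have horth : ∀ s : k, ∑ i, w i * eval (x + s • w) (pderiv i F) = 0 :=
    sum_pderiv_mul_direction_eq_zero hwline
  obtain ⟨a, b, hab, haj, hbj, hall, hwa⟩ : ∃ a b : Fin 3, a ≠ b ∧ a ≠ j ∧ b ≠ j ∧
      (∀ i, i = a ∨ i = b ∨ i = j) ∧ w a ≠ 0 := by
    obtain ⟨a, b, hab, haj, hbj, hall⟩ := exists_other_indices j
    by_cases hwa : w a = 0
    · refine ⟨b, a, hab.symm, hbj, haj, fun i => by rcases hall i with h | h | h <;> simp [h],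
        fun hwb => hw ?_⟩
      have h1 := horth 0
      rw [zero_smul, add_zero] at h1
      have h2 := smul_eq_tangent (n := fun i => eval x (pderiv i F)) hab haj hbj hall h1
      rw [hwa, hwb] at h2
      have h3 : eval x (pderiv j F) • w = 0 := by
        rw [h2]; funext i; simp [tangent]
      rw [map_mul] at hgx
      exact (smul_eq_zero.1 h3).resolve_left (right_ne_zero_of_mul hgx)
    · exact ⟨a, b, hab, haj, hbj, hall, hwa⟩
  let ρ : MvPolynomial (Fin 3) k → Polynomial k := restrict x w
  have hρ : ∀ f s, (ρ f).eval s = eval (x + s • w) f := fun f s => eval_restrict _ _ _ _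
  let n : Fin 3 → Polynomial k := fun i => ρ (pderiv i F)
  let h := ρ (g * pderiv j F)
  have hh0 : h.eval 0 ≠ 0 := by
    rw [hρ, zero_smul, add_zero]; exact hgx
  have hgood : ∀ s, h.eval s ≠ 0 → eval (x + s • w) g ≠ 0 ∧ eval (x + s • w) (pderiv j F) ≠ 0 := by
    intro s hs
    rw [hρ, map_mul] at hs
    exact ⟨left_ne_zero_of_mul hs, right_ne_zero_of_mul hs⟩
  let u : Fin 3 → Polynomial k := tangent n a b j 0 1
  have hu : ∀ s i, (u i).eval s =
      tangent (fun i => eval (x + s • w) (pderiv i F)) a b j 0 1 i := by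
    intro s i
    have h1 := map_tangent (Polynomial.evalRingHom s) n a b j 0 1 i
    simp only [map_zero, map_one, Polynomial.coe_evalRingHom] at h1
    rw [h1]
    congr 1
    funext l
    exact hρ _ _
  -- Of the two lines through `x + s w`, at least one is not parallel to `w`. Its direction can be
  -- scaled to `u(s) + θ w`, with no control yet on how `θ` depends on `s`.
  have hdir : ∀ s, h.eval s ≠ 0 → ∃ θ : k, ∀ τ : k,
      eval (x + s • w + τ • ((fun i => (u i).eval s) + θ • w)) F = 0 := by
    intro s hs
    obtain ⟨hgs, hns⟩ := hgood s hs
    obtain ⟨v, v', hvv', hv, hv'⟩ := htwo _ (hwline s) hgs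
    obtain ⟨y, hy, hyw⟩ : ∃ y : Fin 3 → k, (∀ τ : k, eval (x + s • w + τ • y) F = 0) ∧
        ∃ i l, y i * w l ≠ y l * w i := by
      by_contra! hcon
      obtain ⟨c, hc⟩ := exists_smul_of_parallel hw (hcon v hv)
      obtain ⟨c', hc'⟩ := exists_smul_of_parallel hw (hcon v' hv')
      obtain ⟨i, l, hil⟩ := hvv'
      apply hil
      rw [hc, hc']
      simp only [Pi.smul_apply, smul_eq_mul]
      ring
    have hyo := sum_pderiv_mul_direction_eq_zero hy 0
    rw [zero_smul, add_zero] at hyo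
    obtain ⟨c, θ, hcθ⟩ := exists_smul_eq_tangent_add_smul
      (n := fun i => eval (x + s • w) (pderiv i F)) hab haj hbj hall hns hyo (horth s) hwa hyw
    refine ⟨θ, fun τ => eval_line_eq_zero_of_smul hy (c := c) ?_ τ⟩
    rw [← hcθ]
    congr 1
    funext i
    exact hu s i
  have hindep : ∀ s, h.eval s ≠ 0 → ∀ θ c : k, (fun i => (u i).eval s) + θ • w ≠ c • w := by
    intro s hs θ c hc
    have h1 := congrFun hc a
    have h2 := congrFun hc b
    simp only [Pi.add_apply, Pi.smul_apply, smul_eq_mul, hu, tangent, if_true, if_neg hab.symm]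
      at h1 h2
    apply (hgood s hs).2
    apply mul_left_cancel₀ hwa
    linear_combination w a * h2 - w b * h1
  let H : Fin 3 → Fin 3 → Polynomial k := fun i l => ρ (pderiv l (pderiv i F))
  let B : Polynomial k := ∑ i, ∑ l, u i * Polynomial.C (w l) * H i l
  let E : Polynomial k := ∑ i, ∑ l, u i * u l * H i l
  have hHsymm : ∀ i l, H i l = H l i := fun i l => by
    simp only [H]; rw [pderiv_pderiv_comm]
  have hww : ∀ s : k, ∑ i, ∑ l, w i * w l * (H i l).eval s = 0 := by
    intro s
    rw [← sum_hessian_mul_direction_eq_zero hwline s]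
    simp only [H, hρ]
  -- The Hessian form at `u + θ w` is `E + 2 θ B` plus `θ²` times its value at `w`. That value is
  -- zero because `w` is the direction of a line, so the equation is linear in `θ`.
  have hθ : ∀ s, h.eval s ≠ 0 → ∀ θ : k,
      (∀ τ : k, eval (x + s • w + τ • ((fun i => (u i).eval s) + θ • w)) F = 0) →
      2 * θ * B.eval s + E.eval s = 0 := by
    intro s hs θ hline
    have h1 := sum_hessian_mul_direction_eq_zero hline 0
    rw [zero_smul, add_zero] at h1
    have h2 := hww s
    simp only [← hρ] at h1
    have hs01 : (H 0 1).eval s = (H 1 0).eval s := by rw [hHsymm]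
    have hs02 : (H 0 2).eval s = (H 2 0).eval s := by rw [hHsymm]
    have hs12 : (H 1 2).eval s = (H 2 1).eval s := by rw [hHsymm]
    change ∑ i, ∑ l, _ * _ * (H i l).eval s = 0 at h1
    simp only [B, E, Fin.sum_univ_three, Polynomial.eval_add, Polynomial.eval_mul,
      Polynomial.eval_C, Pi.add_apply, Pi.smul_apply, smul_eq_mul, hs01, hs02, hs12] at h1 h2 ⊢
    linear_combination h1 - θ ^ 2 * h2
  by_cases hB : B = 0
  · right
    have hder : ∀ i, Polynomial.derivative (n i) = ∑ l, Polynomial.C (w l) * H i l :=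
      fun i => derivative_restrict _ _ _
    -- The derivative of the gradient along the line is the Hessian applied to `w`. It is orthogonal
    -- to `w` by isotropy and to `u` because `B = 0`, hence parallel to `n`; by the Wronskian lemma
    -- `n` has a constant direction `c`.
    have hpar : ∀ i, Polynomial.derivative (n i) * n j = n i * Polynomial.derivative (n j) := by
      refine mul_eq_mul_of_orthogonal (m := fun i => Polynomial.derivative (n i))
        (w := fun i => Polynomial.C (w i)) hab haj hbj hall (by simpa using hwa) ?_ ?_ ?_
      · apply Polynomial.funext
        intro s
        rw [Polynomial.eval_zero, ← horth s, Polynomial.eval_finsetSum]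
        simp only [Polynomial.eval_mul, Polynomial.eval_C, n, hρ]
      · apply Polynomial.funext
        intro s
        rw [Polynomial.eval_zero, ← hww s, Polynomial.eval_finsetSum]
        simp only [hder, Polynomial.eval_mul, Polynomial.eval_C, Polynomial.eval_finsetSum,
          Finset.mul_sum, mul_assoc]
      · refine Eq.trans (Finset.sum_congr rfl fun i _ => ?_) hB
        rw [hder, Finset.mul_sum]
        exact Finset.sum_congr rfl fun l _ => (mul_assoc _ _ _).symm
    have hnj0 : (n j).eval 0 ≠ 0 := by
      have := (hgood 0 hh0).2
      rwa [← hρ] at this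
    choose c hc using fun i => exists_eq_C_mul_of_wronskian hnj0 (hpar i)
    have hcn : ∀ (s : k) i, eval (x + s • w) (pderiv i F) = c i * eval (x + s • w) (pderiv j F) := by
      intro s i
      have h1 := congrArg (Polynomial.eval s) (hc i)
      rw [Polynomial.eval_mul, Polynomial.eval_C] at h1
      rw [← hρ, ← hρ]
      exact h1
    have hcj : c j = 1 := by
      have h1 := hcn 0 j
      have h2 := (hgood 0 hh0).2
      exact mul_right_cancel₀ h2 (by linear_combination -h1)
    have hc0 : ∀ s, h.eval s ≠ 0 → ∀ y : Fin 3 → k,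
        ∑ i, y i * eval (x + s • w) (pderiv i F) = 0 → ∑ i, c i * y i = 0 := by
      intro s hs y hy
      apply mul_left_cancel₀ (hgood s hs).2
      rw [mul_zero, ← hy, Finset.mul_sum]
      refine Finset.sum_congr rfl fun i _ => ?_
      rw [hcn s i]; ring
    choose! θ hθline using hdir
    -- The transversal lines at the points of the fixed line all lie in the plane through `x`
    -- orthogonal to `c`. There are infinitely many of them, so `F` divides the equation of this
    -- plane.
    refine exists_constant_direction (x := x) hab haj hbj hall hcj
      (dvd_of_infinite_lines hF ?_)
    have hh : h ≠ 0 := fun h0 => hh0 (by rw [h0, Polynomial.eval_zero])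
    let ℓ : k → Set (Fin 3 → k) := fun s =>
      Set.range fun τ : k => x + s • w + τ • ((fun i => (u i).eval s) + θ s • w)
    have hinj : Set.InjOn ℓ {s | h.eval s ≠ 0} := by
      intro s hs s' hs' hss'
      by_contra hne
      have h1 : x + s' • w ∈ ℓ s := by
        rw [hss']
        exact ⟨0, by simp⟩
      obtain ⟨τ, hτ⟩ := h1
      have h2 : τ • ((fun i => (u i).eval s) + θ s • w) = (s' - s) • w := by
        rw [sub_smul]
        have h3 : x + s • w + τ • ((fun i => (u i).eval s) + θ s • w) = x + s' • w := hτ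
        rw [add_assoc] at h3
        exact eq_sub_of_add_eq' (add_left_cancel h3)
      have hτ0 : τ ≠ 0 := by
        rintro rfl
        rw [zero_smul, eq_comm, smul_eq_zero] at h2
        exact h2.elim (fun h => hne (sub_eq_zero.1 h).symm) hw
      apply hindep s hs (θ s) (τ⁻¹ * (s' - s))
      rw [mul_smul, ← h2, inv_smul_smul₀ hτ0]
    refine ((infinite_setOf_eval_ne_zero hh).image hinj).mono ?_
    rintro _ ⟨s, hs, rfl⟩
    refine ⟨⟨_, _, fun h0 => hindep s hs (θ s) 0 (by rw [h0, zero_smul]), rfl⟩, ?_⟩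
    rintro _ ⟨τ, rfl⟩
    refine ⟨hθline s hs τ, ?_⟩
    have h1 := hc0 s hs w (horth s)
    have h2 := sum_pderiv_mul_direction_eq_zero (hθline s hs) 0
    rw [zero_smul, add_zero] at h2
    have h3 := hc0 s hs _ h2
    simp only [map_sum, map_mul, map_sub, eval_C, eval_X]
    simp only [Fin.sum_univ_three, Pi.add_apply, Pi.smul_apply, smul_eq_mul] at h1 h3 ⊢
    linear_combination s * h1 + τ * h3
  · left
    -- The direction is `u + θ w` with `θ = -E / (2 B)`, multiplied by `2 B`.
    let D : RuledForm k :=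
      ⟨fun i => Polynomial.C (x i) + Polynomial.C (w i) * Polynomial.X,
        fun i => Polynomial.C 2 * B * u i - E * Polynomial.C (w i), 1, one_ne_zero⟩
    have hpt : ∀ s t, D.pt s t = x + s • w + t • fun i =>
        2 * B.eval s * (u i).eval s - E.eval s * w i := by
      intro s t
      funext i
      simp only [RuledForm.pt, D, Polynomial.eval_add, Polynomial.eval_mul, Polynomial.eval_C,
        Polynomial.eval_X, Polynomial.eval_sub, Polynomial.eval_one, Pi.add_apply, Pi.smul_apply,
        smul_eq_mul]
      ring
    have hdirp : ∀ s θ, 2 * θ * B.eval s + E.eval s = 0 →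
        (fun i => 2 * B.eval s * (u i).eval s - E.eval s * w i) =
          (2 * B.eval s) • ((fun i => (u i).eval s) + θ • w) := by
      intro s θ hθs
      funext i
      simp only [Pi.add_apply, Pi.smul_apply, smul_eq_mul]
      linear_combination -w i * hθs
    have hhB : h * B ≠ 0 := mul_ne_zero (fun h0 => hh0 (by rw [h0, Polynomial.eval_zero])) hB
    obtain ⟨s₀, hs₀⟩ := (infinite_setOf_eval_ne_zero hhB).nonempty
    have hD : ∀ s, (h * B).eval s ≠ 0 → D.q.eval s ≠ 0 ∧ (∃ i, (D.p i).eval s ≠ 0) ∧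
        ∀ t, eval (D.pt s t) F = 0 := by
      intro s hs
      rw [Polynomial.eval_mul] at hs
      have hs1 := left_ne_zero_of_mul hs
      have hs2 := right_ne_zero_of_mul hs
      obtain ⟨θ, hline⟩ := hdir s hs1
      have hp := hdirp s θ (hθ s hs1 θ hline)
      refine ⟨by simp [D], ?_, fun t => ?_⟩
      · by_contra! hcon
        have h0 : (2 * B.eval s) • ((fun i => (u i).eval s) + θ • w) = 0 := by
          rw [← hp]
          funext i
          have := hcon i
          simpa [D] using this
        have h1 := (smul_eq_zero.1 h0).resolve_left (mul_ne_zero two_ne_zero hs2)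
        exact hindep s hs1 θ 0 (by rw [h1, zero_smul])
      · rw [hpt, hp]
        exact eval_line_eq_zero_of_smul hline rfl t
    refine ⟨D, D.parametrizes_of_lines hF (h * B) hD hs₀ (u₁ := s₀ + 1) (by simp [D]) ?_, ?_⟩
    · intro t ht
      have hs1 : h.eval s₀ ≠ 0 := by
        have : (h * B).eval s₀ ≠ 0 := hs₀
        rw [Polynomial.eval_mul] at this
        exact left_ne_zero_of_mul this
      obtain ⟨θ, hline⟩ := hdir s₀ hs1
      rw [hpt, hpt, zero_smul, add_zero, hdirp s₀ θ (hθ s₀ hs1 θ hline), add_smul, one_smul,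
        ← add_assoc, smul_smul] at ht
      have h2 := add_left_cancel ht
      have hτ0 : t * (2 * B.eval s₀) ≠ 0 := by
        intro h0
        rw [h0, zero_smul] at h2
        exact hw h2
      apply hindep s₀ hs1 θ (t * (2 * B.eval s₀))⁻¹
      conv_rhs => rw [h2]
      rw [inv_smul_smul₀ hτ0]
    · obtain ⟨-, ⟨i, hi⟩, -⟩ := hD s₀ hs₀
      exact ⟨i, fun h => hi (by rw [h, Polynomial.eval_zero])⟩

end TwoLines

end RuledSurface
end

/-! ### Standardization and removal of base points. -/

noncomputable section
namespace RuledSurface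
open Polynomial

/-- Evaluation of a reflected polynomial. -/
theorem aeval_reflect {k Ω : Type*} [Field k] [Field Ω] [Algebra k Ω] {N : ℕ} {f : k[X]}
    (hf : f.natDegree ≤ N) {x : Ω} (hx : x ≠ 0) :
    aeval x (f.reflect N) = x ^ N * aeval x⁻¹ f := by
  have hx' : x⁻¹ ≠ 0 := inv_ne_zero hx
  let : Invertible x⁻¹ := invertibleOfNonzero hx'
  have h := eval₂_reflect_mul_pow (algebraMap k Ω) x⁻¹ N f hf
  rw [invOf_eq_inv, inv_inv] at h
  rw [aeval_def, aeval_def, ← h, mul_comm, mul_assoc, ← mul_pow, inv_mul_cancel₀ hx, one_pow,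
    mul_one]

theorem eval_reflect {k : Type*} [Field k] {N : ℕ} {f : k[X]} (hf : f.natDegree ≤ N) {x : k}
    (hx : x ≠ 0) : (f.reflect N).eval x = x ^ N * f.eval x⁻¹ := by
  have := aeval_reflect hf hx
  simpa only [coe_aeval_eq_eval] using this

theorem eval_zero_reflect {k : Type*} [Field k] (N : ℕ) (f : k[X]) :
    (f.reflect N).eval 0 = f.coeff N := by
  rw [← coeff_zero_eq_eval_zero, coeff_reflect, revAt_le (Nat.zero_le N), Nat.sub_zero]

namespace RuledForm

variable {k : Type*} [Field k]

/-- Removal of the common factors of the direction polynomials. -/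
theorem exists_no_common_root [Infinite k] {S : Set (Fin 3 → k)} {D : RuledForm k}
    (hD : Parametrizes D.toMap S) (hp : ∃ i, D.p i ≠ 0) :
    ∃ D' : RuledForm k, Parametrizes D'.toMap S ∧ ∀ c : k, ∃ i, (D'.p i).eval c ≠ 0 := by
  obtain ⟨g, hg⟩ := (IsPrincipalIdealRing.principal (Ideal.span (Set.range D.p))).principal
  rw [Ideal.submodule_span_eq] at hg
  have hdvd : ∀ i, g ∣ D.p i := fun i =>
    Ideal.mem_span_singleton.1 (hg ▸ Ideal.subset_span ⟨i, rfl⟩)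
  choose p' hp' using hdvd
  have hg0 : g ≠ 0 := by
    rintro rfl
    obtain ⟨i, hi⟩ := hp
    exact hi (by rw [hp', zero_mul])
  have hmem : g ∈ Ideal.span (Set.range D.p) := hg ▸ Ideal.mem_span_singleton_self g
  obtain ⟨c, hc⟩ := Ideal.mem_span_range_iff_exists_fun.1 hmem
  have hone : ∑ i, c i * p' i = 1 := by
    apply mul_left_cancel₀ hg0
    rw [mul_one, Finset.mul_sum]
    conv_rhs => rw [← hc]
    exact Finset.sum_congr rfl fun i _ => by rw [hp' i]; ring
  refine ⟨⟨D.r, p', D.q, D.q_ne_zero⟩, parametrizes_of_pt_eq hD one_ne_zero hg0 ?_ ?_, ?_⟩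
  · intro u t _ hu
    refine ⟨u, t * g.eval u, hu, ?_⟩
    funext i
    simp only [pt, hp', eval_mul, mul_assoc]
  · intro u t hgu hu
    refine ⟨u, t / g.eval u, hu, ?_⟩
    funext i
    simp only [pt, hp', eval_mul]
    rw [← mul_assoc, div_mul_cancel₀ _ hgu]
  · intro x
    by_contra! hcon
    have h1 := congrArg (eval x) hone
    rw [eval_finsetSum, eval_one, Finset.sum_eq_zero] at h1
    · exact zero_ne_one h1
    · intro i _
      rw [eval_mul, hcon i, mul_zero]

/-- A projective change of the parameter `s` makes the degrees of the direction polynomials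
equal. -/
theorem exists_isStandardized [Infinite k] {S : Set (Fin 3 → k)} {D : RuledForm k}
    (hD : Parametrizes D.toMap S) (hp : ∀ c : k, ∃ i, (D.p i).eval c ≠ 0) :
    ∃ D' : RuledForm k, D'.IsStandardized S := by
  classical
  obtain ⟨a, ha⟩ : ∃ a, ∀ i, D.p i ≠ 0 → (D.p i).eval a ≠ 0 := by
    have h0 : (∏ i, if D.p i = 0 then 1 else D.p i) ≠ 0 :=
      Finset.prod_ne_zero_iff.2 fun i _ => by
        split_ifs with h
        · exact one_ne_zero
        · exact h
    obtain ⟨a, ha⟩ := (infinite_setOf_eval_ne_zero h0).nonempty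
    refine ⟨a, fun i hi => ?_⟩
    have ha' : (∏ i, if D.p i = 0 then 1 else D.p i).eval a ≠ 0 := ha
    rw [eval_prod] at ha'
    have := Finset.prod_ne_zero_iff.1 ha' i (Finset.mem_univ i)
    rwa [if_neg hi] at this
  -- The substitution is `s = a + 1/u`. Multiplication by `u ^ M` clears denominators in `r` and
  -- `q`, by `u ^ N` in `p`; the discrepancy is absorbed by `t`. The nonzero new `pᵢ` have
  -- coefficient `pᵢ(a) ≠ 0` at `u ^ N`, hence degree exactly `N`.
  let M := (∑ i, (D.r i).natDegree) + D.q.natDegree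
  let N := Finset.univ.sup fun i => (D.p i).natDegree
  have hr : ∀ i, (taylor a (D.r i)).natDegree ≤ M := fun i => by
    rw [natDegree_taylor]
    exact (Finset.single_le_sum (f := fun i => (D.r i).natDegree)
      (fun _ _ => Nat.zero_le _) (Finset.mem_univ i)).trans (Nat.le_add_right _ _)
  have hq : (taylor a D.q).natDegree ≤ M := by
    rw [natDegree_taylor]
    exact Nat.le_add_left _ _
  have hpN : ∀ i, (taylor a (D.p i)).natDegree ≤ N := fun i => by
    rw [natDegree_taylor]
    exact Finset.le_sup (f := fun i => (D.p i).natDegree) (Finset.mem_univ i)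
  have hq0 : (taylor a D.q).reflect M ≠ 0 := by
    rw [Ne, reflect_eq_zero_iff, taylor_eq_zero]
    exact D.q_ne_zero
  let D' : RuledForm k := ⟨fun i => (taylor a (D.r i)).reflect M,
    fun i => (taylor a (D.p i)).reflect N, (taylor a D.q).reflect M, hq0⟩
  have hq' : ∀ u, u ≠ 0 → D'.q.eval u = u ^ M * D.q.eval (u⁻¹ + a) := fun u hu => by
    rw [show D'.q = _ from rfl, eval_reflect hq hu, taylor_eval]
  have hp' : ∀ i u, u ≠ 0 → (D'.p i).eval u = u ^ N * (D.p i).eval (u⁻¹ + a) := fun i u hu => by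
    rw [show D'.p i = _ from rfl, eval_reflect (hpN i) hu, taylor_eval]
  have hr' : ∀ i u, u ≠ 0 → (D'.r i).eval u = u ^ M * (D.r i).eval (u⁻¹ + a) := fun i u hu => by
    rw [show D'.r i = _ from rfl, eval_reflect (hr i) hu, taylor_eval]
  have hpt : ∀ u t, u ≠ 0 → D'.pt u t = D.pt (u⁻¹ + a) (t * u ^ N / u ^ M) := by
    intro u t hu
    funext i
    simp only [pt, hq' u hu, hp' i u hu, hr' i u hu]
    have hM : u ^ M ≠ 0 := pow_ne_zero _ hu
    rw [show u ^ M * (D.r i).eval (u⁻¹ + a) + t * (u ^ N * (D.p i).eval (u⁻¹ + a)) =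
      u ^ M * ((D.r i).eval (u⁻¹ + a) + t * u ^ N / u ^ M * (D.p i).eval (u⁻¹ + a)) by
        field_simp, mul_div_mul_left _ _ hM]
  have hpne : ∀ i, D'.p i ≠ 0 → D.p i ≠ 0 := fun i hi h0 => hi (by
    simp only [D', h0, map_zero, reflect_zero])
  have hdeg : ∀ i, D'.p i ≠ 0 → (D'.p i).natDegree = N := by
    intro i hi
    apply le_antisymm
    · exact natDegree_reflect_le.trans (max_le le_rfl (hpN i))
    · apply le_natDegree_of_ne_zero
      simp only [D', coeff_reflect, revAt_le le_rfl, Nat.sub_self, taylor_coeff_zero]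
      exact ha i (hpne i hi)
  have hroot : ∀ c : k, ∃ i, (D'.p i).eval c ≠ 0 := by
    intro c
    by_cases hc : c = 0
    · obtain ⟨i, -, hi⟩ := Finset.exists_mem_eq_sup (Finset.univ : Finset (Fin 3))
        Finset.univ_nonempty (fun i => (D.p i).natDegree)
      by_cases hpi : D.p i = 0
      · obtain ⟨l, hl⟩ := hp 0
        have hN : N = 0 := by
          change Finset.univ.sup (fun i => (D.p i).natDegree) = 0
          rw [hi, hpi, natDegree_zero]
        refine ⟨l, ?_⟩
        have hl0 : D.p l ≠ 0 := fun h => hl (by rw [h, eval_zero])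
        rw [hc, show D'.p l = _ from rfl, eval_zero_reflect, hN, taylor_coeff_zero]
        exact ha l hl0
      · refine ⟨i, ?_⟩
        rw [hc, show D'.p i = _ from rfl, eval_zero_reflect]
        have hN : N = (taylor a (D.p i)).natDegree := by
          rw [natDegree_taylor]; exact hi
        rw [hN, coeff_natDegree, Ne, leadingCoeff_eq_zero, taylor_eq_zero]
        exact hpi
    · obtain ⟨i, hi⟩ := hp (c⁻¹ + a)
      refine ⟨i, ?_⟩
      rw [hp' i c hc]
      exact mul_ne_zero (pow_ne_zero _ hc) hi
  refine ⟨D', ⟨parametrizes_of_pt_eq hD (X_sub_C_ne_zero a) X_ne_zero ?_ ?_, ?_, ?_, ?_⟩⟩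
  · intro u t hu hqu
    rw [eval_sub, eval_X, eval_C] at hu
    have hc := inv_ne_zero hu
    refine ⟨(u - a)⁻¹, t * (u - a)⁻¹ ^ M / (u - a)⁻¹ ^ N, ?_, ?_⟩
    · rw [hq' _ hc, inv_inv, sub_add_cancel]
      exact mul_ne_zero (pow_ne_zero _ hc) hqu
    · rw [hpt _ _ hc, inv_inv, sub_add_cancel, div_mul_cancel₀ _ (pow_ne_zero _ hc),
        mul_div_cancel_right₀ _ (pow_ne_zero _ hc)]
  · intro u t hu hqu
    rw [eval_X] at hu
    rw [hq' u hu] at hqu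
    exact ⟨u⁻¹ + a, _, right_ne_zero_of_mul hqu, hpt u t hu⟩
  · intro i j hi hj
    rw [hdeg i hi, hdeg j hj]
  · obtain ⟨i, hi⟩ := hroot 0
    exact ⟨i, fun h => hi (by rw [h, eval_zero])⟩
  · rintro ⟨c, hc⟩
    obtain ⟨i, hi⟩ := hroot c
    exact hi (hc i fun h => hi (by rw [h, eval_zero]))

/-- Affine base points can be removed by substitutions `t = b + (s - a) τ`. -/
theorem exists_no_affineBasePoint [Infinite k] {S : Set (Fin 3 → k)} (n : ℕ) :
    ∀ D : RuledForm k, D.q.natDegree ≤ n → D.IsStandardized S →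
      ∃ D' : RuledForm k, D'.IsStandardized S ∧ ∀ a b : k, ¬ D'.IsAffineBasePoint a b := by
  induction n with
  | zero =>
    intro D hn hD
    refine ⟨D, hD, fun a b h => ?_⟩
    obtain ⟨c, hc⟩ := natDegree_eq_zero.1 (Nat.le_zero.1 hn)
    have h1 := h.1
    rw [← hc, eval_C] at h1
    exact D.q_ne_zero (by rw [← hc, h1, C_0])
  | succ n ih =>
    intro D hn hD
    by_cases hb : ∀ a b : k, ¬ D.IsAffineBasePoint a b
    · exact ⟨D, hD, hb⟩
    push Not at hb
    obtain ⟨a, b, hq, hr⟩ := hb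
    obtain ⟨q', hq'⟩ := dvd_iff_isRoot.2 hq
    have hr2 : ∀ i, X - C a ∣ D.r i + C b * D.p i := fun i =>
      dvd_iff_isRoot.2 (by simpa [IsRoot] using hr i)
    choose r' hr' using hr2
    have hq0 : q' ≠ 0 := fun h => D.q_ne_zero (by rw [hq', h, mul_zero])
    have hre : ∀ i u, (D.r i).eval u = (u - a) * (r' i).eval u - b * (D.p i).eval u := by
      intro i u
      have := congrArg (eval u) (hr' i)
      simp only [eval_add, eval_mul, eval_C, eval_sub, eval_X] at this
      linear_combination this
    have hqe : ∀ u, D.q.eval u = (u - a) * q'.eval u := by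
      intro u
      rw [hq']
      simp only [eval_mul, eval_C, eval_sub, eval_X]
    -- Putting `t = b + (s - a) τ` makes `s - a` a common factor of numerators and denominator.
    -- Cancelling it lowers the degree of `q` and leaves the `pᵢ` unchanged, so their
    -- standardization persists.
    refine ih ⟨r', D.p, q', hq0⟩ ?_
      ⟨parametrizes_of_pt_eq hD.parametrizes (X_sub_C_ne_zero a) (X_sub_C_ne_zero a) ?_ ?_,
        hD.degree_eq, hD.exists_ne_zero, hD.no_common_root⟩
    · have h1 := hn
      rw [hq', natDegree_mul (X_sub_C_ne_zero a) hq0, natDegree_X_sub_C] at h1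
      change q'.natDegree ≤ n
      omega
    · intro u t hu hqu
      rw [eval_sub, eval_X, eval_C] at hu
      rw [hqe] at hqu
      refine ⟨u, (t - b) / (u - a), right_ne_zero_of_mul hqu, ?_⟩
      funext i
      simp only [pt, hre, hqe]
      have := right_ne_zero_of_mul hqu
      field_simp
      ring
    · intro u t hu hqu
      rw [eval_sub, eval_X, eval_C] at hu
      refine ⟨u, b + (u - a) * t, ?_, ?_⟩
      · rw [hqe]; exact mul_ne_zero hu hqu
      · funext i
        simp only [pt, hre, hqe]
        have hqu' : q'.eval u ≠ 0 := hqu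
        field_simp
        ring

end RuledForm

/-- A rational ruled surface has a standardized ruled parametrization without affine base
points. -/
theorem IsRationalRuledSurface.exists_isStandardized {k : Type*} [Field k] [IsAlgClosed k]
    [CharZero k] {S : Set (Fin 3 → k)} (hS : IsRationalRuledSurface S) :
    ∃ D : RuledForm k, D.IsStandardized S ∧ ∀ a b : k, ¬ D.IsAffineBasePoint a b := by
  obtain ⟨⟨F, hF, rfl⟩, ⟨P, hP⟩, hruled⟩ := hS
  have hlines : ∀ x, MvPolynomial.eval x F = 0 →
      ∃ v : Fin 3 → k, v ≠ 0 ∧ ∀ τ : k, MvPolynomial.eval (x + τ • v) F = 0 := by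
    intro x hx
    obtain ⟨_, ⟨c, v, hv, rfl⟩, ⟨τ₀, rfl⟩, hL⟩ := hruled x hx
    refine ⟨v, hv, fun τ => hL ⟨τ₀ + τ, ?_⟩⟩
    simp only [add_smul, add_assoc]
  have hex : ∃ D : RuledForm k, Parametrizes D.toMap {x | MvPolynomial.eval x F = 0} ∧
      ∃ i, D.p i ≠ 0 := by
    rcases generic_directions hF hlines with ⟨V, g, hg, hV⟩ | ⟨g, hg, htwo⟩
    · exact exists_ruledForm_of_direction hF hP V hg hV
    rcases exists_ruledForm_of_two_lines hF hlines hg htwo with h | ⟨e, ⟨i, hi⟩, he⟩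
    · exact h
    · refine exists_ruledForm_of_direction hF hP (fun i => MvPolynomial.C (e i)) (g := 1)
        (fun h => hF.not_isUnit (isUnit_of_dvd_one h)) fun x hx _ => ?_
      simp only [MvPolynomial.eval_C]
      exact ⟨⟨i, hi⟩, he x hx⟩
  obtain ⟨D, hD, hp⟩ := hex
  obtain ⟨D₁, hD₁, hp₁⟩ := RuledForm.exists_no_common_root hD hp
  obtain ⟨D₂, hD₂⟩ := RuledForm.exists_isStandardized hD₁ hp₁
  exact RuledForm.exists_no_affineBasePoint _ D₂ le_rfl hD₂

end RuledSurface
end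

/-! ### Incidence of points and lines, the line at infinity, and the covering. -/

noncomputable section
namespace RuledSurface
open Polynomial

section Elimination

variable {k : Type*} [Field k] [IsAlgClosed k]

/-- The set of points at which finitely many polynomials in one variable have a common root is
closed, up to common roots at infinity. -/
theorem exists_common_root_of_closure {ι : Type*} [Fintype ι] {N : ℕ}
    {E : ι → (MvPolynomial (Fin 3) k)[X]} (hE : ∀ m, (E m).natDegree ≤ N)
    {A : Set (Fin 3 → k)}
    (hA : ∀ x ∈ A, ∃ s, ∀ m, ((E m).map (MvPolynomial.eval x)).eval s = 0)
    {x₀ : Fin 3 → k}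
    (hx₀ : ∀ G : MvPolynomial (Fin 3) k, (∀ x ∈ A, MvPolynomial.eval x G = 0) →
      MvPolynomial.eval x₀ G = 0) :
    (∃ s, ∀ m, ((E m).map (MvPolynomial.eval x₀)).eval s = 0) ∨
      ∀ m, MvPolynomial.eval x₀ ((E m).coeff N) = 0 := by
  classical
  by_contra! hcon
  obtain ⟨hroot, m₀, hm₀⟩ := hcon
  set f := E m₀ with hf
  by_cases hN : N = 0
  · apply hm₀
    apply hx₀
    intro x hx
    obtain ⟨s, hs⟩ := hA x hx
    have h1 := hs m₀
    have h2 : E m₀ = C ((E m₀).coeff 0) :=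
      eq_C_of_natDegree_le_zero ((hE m₀).trans hN.le)
    rw [h2, map_C, eval_C] at h1
    rw [hN]
    exact h1
  set f₀ := f.map (MvPolynomial.eval x₀) with hf₀
  have hcoeff : f₀.coeff N ≠ 0 := by rwa [hf₀, coeff_map]
  have hdeg : f₀.natDegree = N :=
    le_antisymm (natDegree_map_le.trans (hE m₀)) (le_natDegree_of_ne_zero hcoeff)
  have hf₀0 : f₀ ≠ 0 := fun h => hcoeff (by rw [h, coeff_zero])
  choose μ hμ using hroot
  let Λ : k → MvPolynomial ι k := fun s =>
    ∑ m, MvPolynomial.C (((E m).map (MvPolynomial.eval x₀)).eval s) * MvPolynomial.X m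
  have hΛ : ∀ s, Λ s ≠ 0 := by
    intro s h0
    apply hμ s
    have h1 := congrArg (MvPolynomial.eval (Pi.single (μ s) 1)) h0
    simp only [Λ, map_sum, map_mul, MvPolynomial.eval_C, MvPolynomial.eval_X, map_zero] at h1
    rw [Finset.sum_eq_single (μ s)] at h1
    · simpa using h1
    · intro m _ hm
      rw [Pi.single_eq_of_ne hm, mul_zero]
    · simp
  -- At each of the finitely many roots of `f₀` some `E m` is nonzero, so a general linear
  -- combination `g` of the `E m` shares no root with `f₀`. Then `resultant f g N N` is nonzero at
  -- `x₀`, although it vanishes on `A`.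
  obtain ⟨c, hc⟩ : ∃ c : ι → k, MvPolynomial.eval c (∏ s ∈ f₀.roots.toFinset, Λ s) ≠ 0 := by
    by_contra! hcon
    have h0 : (∏ s ∈ f₀.roots.toFinset, Λ s) = 0 :=
      MvPolynomial.funext fun c => by rw [hcon c, map_zero]
    exact Finset.prod_ne_zero_iff.2 (fun s _ => hΛ s) h0
  rw [map_prod] at hc
  set g := ∑ m, C (MvPolynomial.C (c m)) * E m with hg
  have hgdeg : g.natDegree ≤ N :=
    natDegree_sum_le_of_forall_le _ _ fun m _ => (natDegree_C_mul_le _ _).trans (hE m)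
  have hgmap : ∀ x s, (g.map (MvPolynomial.eval x)).eval s =
      ∑ m, c m * ((E m).map (MvPolynomial.eval x)).eval s := by
    intro x s
    simp only [hg, Polynomial.map_sum, Polynomial.map_mul, map_C, MvPolynomial.eval_C,
      eval_finsetSum, eval_mul, eval_C]
  have hres₀ : MvPolynomial.eval x₀ (resultant f g N N) ≠ 0 := by
    rw [← resultant_map_map, ← hf₀]
    have h1 := resultant_eq_prod_eval f₀ (g.map (MvPolynomial.eval x₀)) N
      (natDegree_map_le.trans hgdeg) (IsAlgClosed.splits f₀)
    rw [hdeg] at h1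
    rw [h1]
    refine mul_ne_zero (pow_ne_zero _ (leadingCoeff_ne_zero.2 hf₀0)) ?_
    rw [Ne, Multiset.prod_eq_zero_iff, Multiset.mem_map]
    rintro ⟨s, hs, hs0⟩
    apply Finset.prod_ne_zero_iff.1 hc s (Multiset.mem_toFinset.2 hs)
    rw [hgmap] at hs0
    simp only [Λ, map_sum, map_mul, MvPolynomial.eval_C, MvPolynomial.eval_X]
    rw [← hs0]
    exact Finset.sum_congr rfl fun m _ => mul_comm _ _
  apply hres₀
  apply hx₀
  intro x hx
  obtain ⟨s, hs⟩ := hA x hx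
  obtain ⟨p, q, -, -, hpq⟩ := exists_mul_add_mul_eq_C_resultant f g (hE m₀) hgdeg (Or.inl hN)
  have h1 := congrArg (fun h => (h.map (MvPolynomial.eval x)).eval s) hpq
  simp only [Polynomial.map_add, Polynomial.map_mul, eval_add, eval_mul, map_C, eval_C, hgmap,
    hs] at h1
  rw [← h1, hf, hs m₀]
  simp

end Elimination

namespace RuledForm

variable {k : Type*} [Field k] (D : RuledForm k)

/-- The moments `rᵢ pₘ - rₘ pᵢ` of the lines of a ruled form. -/
def moment (i m : Fin 3) : k[X] := D.r i * D.p m - D.r m * D.p i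

/-- The equations of the incidence relation between points of space and lines of a ruled form. -/
def incidence (im : Fin 3 × Fin 3) : (MvPolynomial (Fin 3) k)[X] :=
  C (MvPolynomial.X im.1) * (D.q * D.p im.2).map MvPolynomial.C -
    C (MvPolynomial.X im.2) * (D.q * D.p im.1).map MvPolynomial.C -
    (D.moment im.1 im.2).map MvPolynomial.C

/-- These are the minors of the two columns `q x - r` and `p`; written without division by `q`, they
make sense for every parameter. -/
theorem map_incidence (x : Fin 3 → k) (im : Fin 3 × Fin 3) :
    (D.incidence im).map (MvPolynomial.eval x) =
      C (x im.1) * (D.q * D.p im.2) - C (x im.2) * (D.q * D.p im.1) - D.moment im.1 im.2 := by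
  have h : (MvPolynomial.eval x).comp (MvPolynomial.C : k →+* MvPolynomial (Fin 3) k) =
      RingHom.id k := by
    ext c; simp
  simp only [incidence, Polynomial.map_sub, Polynomial.map_mul, map_C, MvPolynomial.eval_X,
    Polynomial.map_map, h, Polynomial.map_id]

theorem eval_coeff_incidence (x : Fin 3 → k) (im : Fin 3 × Fin 3) (N : ℕ) :
    MvPolynomial.eval x ((D.incidence im).coeff N) =
      x im.1 * (D.q * D.p im.2).coeff N - x im.2 * (D.q * D.p im.1).coeff N -
        (D.moment im.1 im.2).coeff N := by
  rw [← coeff_map, map_incidence]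
  simp only [coeff_sub, coeff_C_mul]

theorem natDegree_incidence_le {N : ℕ} (hq : ∀ i, (D.q * D.p i).natDegree ≤ N)
    (hm : ∀ i m, (D.moment i m).natDegree ≤ N) (im : Fin 3 × Fin 3) :
    (D.incidence im).natDegree ≤ N := by
  refine (natDegree_sub_le _ _).trans (max_le ((natDegree_sub_le _ _).trans (max_le ?_ ?_)) ?_)
  · exact (natDegree_C_mul_le _ _).trans (natDegree_map_le.trans (hq _))
  · exact (natDegree_C_mul_le _ _).trans (natDegree_map_le.trans (hq _))
  · exact natDegree_map_le.trans (hm _ _)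

theorem eval_map_incidence_pt {u : k} (hu : D.q.eval u ≠ 0) (t : k) (im : Fin 3 × Fin 3) :
    ((D.incidence im).map (MvPolynomial.eval (D.pt u t))).eval u = 0 := by
  rw [map_incidence]
  simp only [eval_sub, eval_mul, eval_C, moment, pt]
  field_simp
  ring

variable {D} {S : Set (Fin 3 → k)}

/-- Points incident to a line of a ruled form without base points are values of the ruled form. -/
theorem mem_image_of_incidence (hD : D.IsStandardized S)
    (hb : ∀ a b : k, ¬ D.IsAffineBasePoint a b) {x : Fin 3 → k} {s : k}
    (h : ∀ im, ((D.incidence im).map (MvPolynomial.eval x)).eval s = 0) :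
    x ∈ image D.toMap := by
  have hp : (fun i => (D.p i).eval s) ≠ 0 := fun h0 =>
    hD.no_common_root ⟨s, fun i _ => congrFun h0 i⟩
  obtain ⟨t, ht⟩ := exists_smul_of_parallel (v := fun i => D.q.eval s * x i - (D.r i).eval s) hp
    (fun i m => by
      have h1 := h (i, m)
      rw [map_incidence] at h1
      simp only [eval_sub, eval_mul, eval_C, moment] at h1
      linear_combination h1)
  have ht' : ∀ i, D.q.eval s * x i - (D.r i).eval s = t * (D.p i).eval s := congrFun ht
  -- If `q(s) = 0`, the incidence relation `q x - r = t p` says that `(s, t)` is an affine base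
  -- point.
  have hq : D.q.eval s ≠ 0 := by
    intro hq
    refine hb s t ⟨hq, fun i => ?_⟩
    have := ht' i
    rw [hq] at this
    linear_combination -this
  have hx : x = D.pt s t := by
    funext i
    simp only [pt]
    rw [eq_div_iff hq]
    linear_combination ht' i
  rw [hx]
  exact D.pt_mem_image hq t

/-- A point of the surface outside the image of a ruled form without base points lies on the line
at the infinite parameter. -/
theorem mem_image_or_coeff_eq_zero [IsAlgClosed k] (hD : D.IsStandardized S)
    (hb : ∀ a b : k, ¬ D.IsAffineBasePoint a b) {N : ℕ}
    (hq : ∀ i, (D.q * D.p i).natDegree ≤ N) (hm : ∀ i m, (D.moment i m).natDegree ≤ N)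
    {x : Fin 3 → k} (hx : x ∈ S) :
    x ∈ image D.toMap ∨ ∀ i m, x i * (D.q * D.p m).coeff N - x m * (D.q * D.p i).coeff N -
      (D.moment i m).coeff N = 0 := by
  have h := exists_common_root_of_closure (D.natDegree_incidence_le hq hm)
    (A := {x | ∃ u t, D.q.eval u ≠ 0 ∧ x = D.pt u t}) (x₀ := x) (by
      rintro _ ⟨u, t, hu, rfl⟩
      exact ⟨u, D.eval_map_incidence_pt hu t⟩) (by
      intro G hG
      have h1 : G ∈ MvPolynomial.vanishingIdeal k (image D.toMap) := by
        rw [D.mem_vanishingIdeal_iff one_ne_zero]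
        exact fun u t _ hu => hG _ ⟨u, t, hu, rfl⟩
      rw [← hD.parametrizes] at hx
      simpa [MvPolynomial.aeval_eq_eval] using hx G h1)
  rcases h with ⟨s, hs⟩ | h
  · exact Or.inl (mem_image_of_incidence hD hb hs)
  · right
    intro i m
    rw [← D.eval_coeff_incidence x (i, m)]
    exact h (i, m)

variable (D) in
/-- The ruled form of `ℋ(s,t) = 𝒬(1/s,t)`. -/
def atInfinity (j : Fin 3) (hj : D.p j ≠ 0) (N : ℕ) : RuledForm k where
  r i := (D.moment i j).reflect N
  p i := (D.q * D.p i).reflect N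
  q := (D.q * D.p j).reflect N
  q_ne_zero := by
    rw [Ne, reflect_eq_zero_iff]
    exact mul_ne_zero D.q_ne_zero hj

theorem aeval_inv_paramS_ne_zero {f : k[X]} (hf : f ≠ 0) : aeval (paramS k)⁻¹ f ≠ 0 := by
  have hinj := IsFractionRing.injective (MvPolynomial (Fin 2) k) (FunctionField k)
  have hs : paramS k ≠ 0 := fun h =>
    MvPolynomial.X_ne_zero (R := k) (0 : Fin 2) (hinj (h.trans (map_zero _).symm))
  have h1 : aeval (paramS k) (f.reflect f.natDegree) ≠ 0 := by
    rw [aeval_paramS]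
    intro h
    refine aeval_X_zero_ne_zero ?_ (hinj (h.trans (map_zero _).symm))
    rwa [Ne, reflect_eq_zero_iff]
  rw [aeval_reflect le_rfl hs] at h1
  exact right_ne_zero_of_mul h1

/-- The substitution in `𝒬` turns the `i`-th component into `(rᵢ pⱼ - rⱼ pᵢ + t q pᵢ) / (q pⱼ)`. At
`1/s`, multiplying numerator and denominator by `s ^ N` gives the reflected polynomials. -/
theorem mapH_eq_toMap_atInfinity {j : Fin 3} (hj : D.p j ≠ 0) {N : ℕ}
    (hq : ∀ i, (D.q * D.p i).natDegree ≤ N) (hm : ∀ i m, (D.moment i m).natDegree ≤ N) :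
    D.mapH j = (D.atInfinity j hj N).toMap := by
  have hinj := IsFractionRing.injective (MvPolynomial (Fin 2) k) (FunctionField k)
  have hs : paramS k ≠ 0 := fun h =>
    MvPolynomial.X_ne_zero (R := k) (0 : Fin 2) (hinj (h.trans (map_zero _).symm))
  funext i
  simp only [mapH, substQ, subst, toMap, atInfinity, one_div]
  rw [aeval_reflect (hm i j) hs, aeval_reflect (hq i) hs, aeval_reflect (hq j) hs]
  have h1 := aeval_inv_paramS_ne_zero D.q_ne_zero
  have h2 := aeval_inv_paramS_ne_zero hj
  have h3 : paramS k ^ N ≠ 0 := pow_ne_zero _ hs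
  simp only [moment, map_sub, map_mul]
  generalize aeval (paramS k)⁻¹ D.q = Q at *
  generalize aeval (paramS k)⁻¹ (D.p j) = pj at *
  field_simp
  ring

theorem parametrizes_atInfinity [Infinite k] (hD : Parametrizes D.toMap S) {j : Fin 3}
    (hj : D.p j ≠ 0) {N : ℕ} (hq : ∀ i, (D.q * D.p i).natDegree ≤ N)
    (hm : ∀ i m, (D.moment i m).natDegree ≤ N) :
    Parametrizes (D.atInfinity j hj N).toMap S := by
  have hpt : ∀ u t, u ≠ 0 → D.q.eval u⁻¹ ≠ 0 → (D.p j).eval u⁻¹ ≠ 0 →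
      (D.atInfinity j hj N).pt u t =
        D.pt u⁻¹ ((D.q.eval u⁻¹ * t - (D.r j).eval u⁻¹) / (D.p j).eval u⁻¹) := by
    intro u t hu h1 h2
    funext i
    simp only [pt, atInfinity]
    rw [eval_reflect (hm i j) hu, eval_reflect (hq i) hu, eval_reflect (hq j) hu]
    have h3 : u ^ N ≠ 0 := pow_ne_zero _ hu
    simp only [moment, eval_sub, eval_mul]
    generalize D.q.eval u⁻¹ = Q at *
    generalize (D.p j).eval u⁻¹ = pj at *
    field_simp
    ring
  have hden : ∀ u, u ≠ 0 → (D.atInfinity j hj N).q.eval u =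
      u ^ N * (D.q.eval u⁻¹ * (D.p j).eval u⁻¹) := by
    intro u hu
    rw [show (D.atInfinity j hj N).q = (D.q * D.p j).reflect N from rfl,
      eval_reflect (hq j) hu, eval_mul]
  refine parametrizes_of_pt_eq hD (mul_ne_zero X_ne_zero hj) X_ne_zero ?_ ?_
  · intro u t hu hqu
    rw [eval_mul, eval_X] at hu
    have hu0 := left_ne_zero_of_mul hu
    have hpu := right_ne_zero_of_mul hu
    refine ⟨u⁻¹, ((D.r j).eval u + t * (D.p j).eval u) / D.q.eval u, ?_, ?_⟩
    · rw [hden _ (inv_ne_zero hu0), inv_inv]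
      exact mul_ne_zero (pow_ne_zero _ (inv_ne_zero hu0)) (mul_ne_zero hqu hpu)
    · rw [hpt _ _ (inv_ne_zero hu0) (by rwa [inv_inv]) (by rwa [inv_inv]), inv_inv]
      congr 1
      field_simp
      ring
  · intro u t hu hqu
    rw [eval_X] at hu
    rw [hden u hu] at hqu
    have h1 := right_ne_zero_of_mul hqu
    exact ⟨u⁻¹, _, left_ne_zero_of_mul h1,
      hpt u t hu (left_ne_zero_of_mul h1) (right_ne_zero_of_mul h1)⟩

/-- The Plücker relation between the leading coefficients of the moments and directions. -/
theorem coeff_moment_relation {N : ℕ} (hq : ∀ i, (D.q * D.p i).natDegree ≤ N)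
    (hm : ∀ i m, (D.moment i m).natDegree ≤ N) (i m j : Fin 3) :
    (D.q * D.p j).coeff N * (D.moment i m).coeff N =
      (D.q * D.p m).coeff N * (D.moment i j).coeff N -
        (D.q * D.p i).coeff N * (D.moment m j).coeff N := by
  -- Products of coefficients at `N` are coefficients at `N + N` of products, so the relation
  -- follows from an identity of polynomials.
  rw [← coeff_mul_add_eq_of_natDegree_le (hq j) (hm i m), ← coeff_mul_add_eq_of_natDegree_le (hq m) (hm i j),
    ← coeff_mul_add_eq_of_natDegree_le (hq i) (hm m j), ← coeff_sub]
  congr 1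
  simp only [moment]
  ring

/-- A standardized ruled parametrization without affine base points covers the surface, possibly
up to the line at the infinite parameter. -/
theorem IsStandardized.covers [IsAlgClosed k] (hD : D.IsStandardized S)
    (hb : ∀ a b : k, ¬ D.IsAffineBasePoint a b) :
    image D.toMap = S ∨
      ∃ L : Set (Fin 3 → k), IsLine L ∧ L ⊆ S ∧ S \ image D.toMap ⊆ L ∧
        ∀ j : Fin 3, D.p j ≠ 0 →
          IsInRuledForm (D.mapH j) ∧ Parametrizes (D.mapH j) S ∧
          (∃ c v : Fin 3 → k, v ≠ 0 ∧ L = Set.range (fun τ : k => c + τ • v) ∧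
            ∀ τ : k, HasValueAt (D.mapH j) ![0, τ] (c + τ • v)) ∧
          image D.toMap ∪ image (D.mapH j) = S := by
  obtain ⟨j₀, hj₀⟩ := hD.exists_ne_zero
  set e := D.q.natDegree + (D.p j₀).natDegree with he
  have hqe : ∀ i, (D.q * D.p i).natDegree ≤ e := by
    intro i
    by_cases hi : D.p i = 0
    · rw [hi, mul_zero, natDegree_zero]; exact Nat.zero_le _
    · rw [natDegree_mul D.q_ne_zero hi, hD.degree_eq i j₀ hi hj₀]
  -- If some moment has degree above `e`, then at the maximal such degree `N` the terms with `q pᵢ`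
  -- have no coefficient. The equations at infinity then ask a leading coefficient to vanish, so no
  -- point of the surface is missed.
  by_cases hme : ∀ i m, (D.moment i m).natDegree ≤ e
  swap
  · left
    refine Set.Subset.antisymm hD.parametrizes.image_subset fun x hx => ?_
    push Not at hme
    obtain ⟨i₁, m₁, hlt⟩ := hme
    obtain ⟨im, him⟩ := Finite.exists_max fun im : Fin 3 × Fin 3 =>
      (D.moment im.1 im.2).natDegree
    obtain ⟨N, hN⟩ : ∃ N, N = (D.moment im.1 im.2).natDegree := ⟨_, rfl⟩
    have hmN : ∀ i m, (D.moment i m).natDegree ≤ N := fun i m => hN ▸ him (i, m)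
    have heN : e < N := hlt.trans_le (hmN i₁ m₁)
    have hq0 : ∀ i, (D.q * D.p i).coeff N = 0 := fun i =>
      coeff_eq_zero_of_natDegree_lt ((hqe i).trans_lt heN)
    refine (mem_image_or_coeff_eq_zero hD hb (fun i => (hqe i).trans heN.le) hmN hx).resolve_right
      fun h => ?_
    have h1 := h im.1 im.2
    rw [hq0, hq0, mul_zero, mul_zero, sub_zero, zero_sub, neg_eq_zero] at h1
    have h2 : (D.moment im.1 im.2).leadingCoeff = 0 := by
      rw [leadingCoeff, ← hN]
      exact h1
    rw [leadingCoeff_eq_zero.1 h2, natDegree_zero] at hN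
    omega
  right
  -- Equality of the degrees of the nonzero `pⱼ` enters here: the denominator of `ℋ` is nonzero at
  -- `s = 0` for every admissible `j`.
  have hlead : ∀ j, D.p j ≠ 0 → (D.q * D.p j).coeff e ≠ 0 := by
    intro j hj
    have h1 : e = (D.q * D.p j).natDegree := by
      rw [natDegree_mul D.q_ne_zero hj, hD.degree_eq j j₀ hj hj₀]
    rw [h1, coeff_natDegree, Ne, leadingCoeff_eq_zero]
    exact mul_ne_zero D.q_ne_zero hj
  -- Defining `L` by equations makes it independent of `j`; each admissible `j` then gives a
  -- parametrization of it whose parameter is the `j`-th coordinate.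
  set L : Set (Fin 3 → k) := {x | ∀ i m, x i * (D.q * D.p m).coeff e -
    x m * (D.q * D.p i).coeff e - (D.moment i m).coeff e = 0} with hL
  have hline : ∀ j (hj : D.p j ≠ 0), ∃ c v : Fin 3 → k, v ≠ 0 ∧
      L = Set.range (fun τ : k => c + τ • v) ∧
      ∀ τ : k, HasValueAt (D.mapH j) ![0, τ] (c + τ • v) := by
    intro j hj
    have hK := hlead j hj
    refine ⟨fun i => (D.moment i j).coeff e / (D.q * D.p j).coeff e,
      fun i => (D.q * D.p i).coeff e / (D.q * D.p j).coeff e, ?_, ?_, ?_⟩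
    · intro h
      have := congrFun h j
      rw [div_self hK] at this
      exact one_ne_zero this
    · ext x
      constructor
      · intro hx
        refine ⟨x j, ?_⟩
        funext i
        have h1 := hx i j
        simp only [Pi.add_apply, Pi.smul_apply, smul_eq_mul]
        field_simp
        linear_combination -h1
      · rintro ⟨τ, rfl⟩ i m
        have h1 := coeff_moment_relation hqe hme i m j
        simp only [Pi.add_apply, Pi.smul_apply, smul_eq_mul]
        field_simp
        linear_combination -h1
    · intro τ
      rw [mapH_eq_toMap_atInfinity hj hqe hme]
      have h0 : (D.atInfinity j hj e).q.eval 0 ≠ 0 := by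
        rw [show (D.atInfinity j hj e).q = (D.q * D.p j).reflect e from rfl, eval_zero_reflect]
        exact hK
      convert (D.atInfinity j hj e).hasValueAt_pt h0 τ using 1
      funext i
      simp only [pt, atInfinity, eval_zero_reflect, Pi.add_apply, Pi.smul_apply, smul_eq_mul]
      ring
  have hparam : ∀ j, D.p j ≠ 0 → Parametrizes (D.mapH j) S := by
    intro j hj
    rw [mapH_eq_toMap_atInfinity hj hqe hme]
    exact parametrizes_atInfinity hD.parametrizes hj hqe hme
  have hLimage : ∀ j, D.p j ≠ 0 → L ⊆ image (D.mapH j) := by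
    intro j hj
    obtain ⟨c, v, -, hLcv, hval⟩ := hline j hj
    rw [hLcv]
    rintro _ ⟨τ, rfl⟩
    exact ⟨_, hval τ⟩
  have hdiff : S \ image D.toMap ⊆ L := by
    rintro x ⟨hxS, hx⟩
    exact (mem_image_or_coeff_eq_zero hD hb hqe hme hxS).resolve_left hx
  refine ⟨L, ?_, (hLimage j₀ hj₀).trans (hparam j₀ hj₀).image_subset, hdiff, fun j hj =>
    ⟨⟨_, mapH_eq_toMap_atInfinity hj hqe hme⟩, hparam j hj, hline j hj, ?_⟩⟩
  · obtain ⟨c, v, hv, hLcv, -⟩ := hline j₀ hj₀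
    exact ⟨c, v, hv, hLcv⟩
  · refine Set.Subset.antisymm
      (Set.union_subset hD.parametrizes.image_subset (hparam j hj).image_subset) fun x hx => ?_
    by_cases h : x ∈ image D.toMap
    · exact Or.inl h
    · exact Or.inr (hLimage j hj (hdiff ⟨hx, h⟩))

end RuledForm

end RuledSurface
end

theorem mainTheorem1 {k : Type*} [Field k] [IsAlgClosed k] [CharZero k]
    (S : Set (Fin 3 → k)) (hS : RuledSurface.IsRationalRuledSurface S) :
    (∃ D : RuledSurface.RuledForm k,
      D.IsStandardized S ∧ ∀ a b : k, ¬ D.IsAffineBasePoint a b) ∧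
    ∀ D : RuledSurface.RuledForm k, D.IsStandardized S →
      (∀ a b : k, ¬ D.IsAffineBasePoint a b) →
      RuledSurface.image D.toMap = S ∨
      ∃ L : Set (Fin 3 → k), RuledSurface.IsLine L ∧ L ⊆ S ∧
        S \ RuledSurface.image D.toMap ⊆ L ∧
        ∀ j : Fin 3, D.p j ≠ 0 →
          RuledSurface.IsInRuledForm (D.mapH j) ∧
          RuledSurface.Parametrizes (D.mapH j) S ∧
          (∃ c v : Fin 3 → k, v ≠ 0 ∧ L = Set.range (fun τ : k => c + τ • v) ∧
            ∀ τ : k, RuledSurface.HasValueAt (D.mapH j) ![0, τ] (c + τ • v)) ∧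
          RuledSurface.image D.toMap ∪ RuledSurface.image (D.mapH j) = S :=
  ⟨hS.exists_isStandardized, fun _ hD hb => hD.covers hb⟩
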